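/- Let $K$ be a perfect field of characteristic $p>0$, let $f_1,\ldots,f_m\in P_n=K[x_1,\ldots,x_n]$ generate a prime, non-maximal ideal $I$, and let $A=S^{-1}(P_n/I)$ be a localization of $P_n/I$ at a multiplicative subset $S$ such that $A$ is a domain; write $\overline{g}\in A$ for the image of $g\in P_n$ (and $x_l$ for $\overline{x}_l$). Let $\overline J=(\overline{\partial f_i/\partial x_j})$ be the Jacobi matrix over $A$, $r$ its rank over $\mathrm{Frac}(A)$, and let $\mathbf i=(i_1<\cdots<i_r)$ in $\{1,\ldots,m\}$ and $\mathbf j=(j_1<\cdots<j_r)$ in $\{1,\ldots,n\}$ be such that the minor $\Delta=\det(\overline J_{i_\nu j_\mu})_{\nu,\mu=1}^{r}$ is nonzero. Let $\{j_{r+1},\ldots,j_n\}=\{1,\ldots,n\}\setminus\{j_1,\ldots,j_r\}$ and let $A_\Delta$ be the localization of $A$ at the powers of $\Delta$. For a commutative $K$-algebra $B$, let $\mathcal D(B)_0\subseteq\mathrm{End}_K(B)$ be the set of multiplications by elements of $B$, $\mathcal D(B)_l=\{u\in\mathrm{End}_K(B): [b,u]\in\mathcal D(B)_{l-1}\text{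 for all }b\in B\}$ for $l\ge1$, and $\mathcal D(B)=\bigcup_l\mathcal D(B)_l$. A higher derivation of $B$ is a sequence $\delta=(\delta^{[k]})_{k\ge0}$ in $\mathrm{End}_K(B)$ with $\delta^{[0]}=\mathrm{id}$ and $\delta^{[k]}(ab)=\sum_{s+t=k}\delta^{[s]}(a)\delta^{[t]}(b)$; it is iterative if $\delta^{[k]}\delta^{[l]}=\binom{k+l}{k}\delta^{[k+l]}$ for all $k,l$. $HS_K(B)$ is the set of higher derivations of $B$. Then for each $\nu=r+1,\ldots,n$ there is a derivation $\partial_{\mathbf i;\mathbf j,j_\nu}\in\mathrm{Der}_K(A_\Delta)$ such that, for every $g\in P_n$, $\partial_{\mathbf i;\mathbf j,j_\nu}(\overline g)$ is the determinant of the $(r+1)\times(r+1)$ matrix whose first $r$ rows are the rows $i_1,\ldots,i_r$ of $\overline J$ restricted to the columns $j_1,\ldots,j_r,j_\nu$, and whose last row is $\overline{\partial g/\partial x_{j_1}},\ldots,\overline{\partial g/\partial x_{j_r}},\overline{\partial g/\partial x_{j_\nu}}$. Moreover, for each $\nu$ there is a unique iterative higher derivation $(\delta^{[k]}_{\mathbf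 i;\mathbf j,j_\nu})_{k\ge0}$ of $A_\Delta$ with $\delta^{[1]}_{\mathbf i;\mathbf j,j_\nu}=\Delta^{-1}\partial_{\mathbf i;\mathbf j,j_\nu}$ that acts on $K[x_{j_{r+1}},\ldots,x_{j_n}]$ as the divided powers of $\partial/\partial x_{j_\nu}$, i.e. $\delta^{[k]}_{\mathbf i;\mathbf j,j_\nu}\bigl(\prod_\mu x_{j_\mu}^{\alpha_\mu}\bigr)=\binom{\alpha_\nu}{k}x_{j_\nu}^{\alpha_\nu-k}\prod_{\mu\ne\nu}x_{j_\mu}^{\alpha_\mu}$. All the maps $\delta^{[k]}_{\mathbf i;\mathbf j,j_\nu}$ ($k\ge0$, $r<\nu\le n$) commute, and, with $\delta^{[\mathbf k]}:=\delta_{\mathbf i;\mathbf j,j_{r+1}}^{[k_{r+1}]}\cdots\delta_{\mathbf i;\mathbf j,j_n}^{[k_n]}$ for $\mathbf k=(k_{r+1},\ldots,k_n)\in\mathbb N^{n-r}$: 1. $\mathcal D(A_\Delta)$ is a simple algebra; it is free as a left and as a right $A_\Delta$-module on the $\delta^{[\mathbf k]}$, that is, $\mathcal D(A_\Delta)=\bigoplus_{\mathbf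 k}A_\Delta\,\delta^{[\mathbf k]}=\bigoplus_{\mathbf k}\delta^{[\mathbf k]}A_\Delta$; and it is generated as a $K$-algebra by $A$ and the components of all higher derivations in $HS_K(A_\Delta)$. 2. $\mathrm{Der}_K(A_\Delta)=\bigoplus_{\nu=r+1}^nA_\Delta\,\partial_{\mathbf i;\mathbf j,j_\nu}$ is free on the $\partial_{\mathbf i;\mathbf j,j_\nu}$. 3. For each $l\ge0$, $\mathcal D(A_\Delta)_l=\bigoplus_{k_{r+1}+\cdots+k_n\le l}A_\Delta\,\delta^{[\mathbf k]}=\bigoplus_{k_{r+1}+\cdots+k_n\le l}\delta^{[\mathbf k]}A_\Delta$. -/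

import Mathlib

namespace DiffOps

noncomputable section

/-! ### The ring of differential operators and its order filtration -/

section Operators

variable (K B : Type*) [CommRing K] [CommRing B] [Algebra K B]

/-- The `K`-linear differential operators of order at most `l` on a commutative `K`-algebra `B`:
order at most `0` means multiplication by an element of `B`, and `u` has order at most `l + 1` if
`[b, u] = b u - u b` has order at most `l` for every `b` in `B`. -/
def diffOpOrder : ℕ → Submodule K (Module.End K B)
  | 0 => LinearMap.range (Algebra.lmul K B).toLinearMap
  | l + 1 =>
    { carrier := {u | ∀ b : B, Algebra.lmul K B b * u - u * Algebra.lmul K B b ∈ diffOpOrder l}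
      add_mem' := by
        intro u v hu hv b
        have := (diffOpOrder l).add_mem (hu b) (hv b)
        convert this using 1
        noncomm_ring
      zero_mem' := by
        intro b
        simp
      smul_mem' := by
        intro c u hu b
        have := (diffOpOrder l).smul_mem c (hu b)
        convert this using 1
        rw [smul_sub, mul_smul_comm, smul_mul_assoc] }

variable {K B}

theorem mem_diffOpOrder_succ {l : ℕ} {u : Module.End K B} :
    u ∈ diffOpOrder K B (l + 1) ↔
      ∀ b : B, Algebra.lmul K B b * u - u * Algebra.lmul K B b ∈ diffOpOrder K B l :=
  Iff.rfl

theorem lmul_mem_diffOpOrder_zero (b : B) : Algebra.lmul K B b ∈ diffOpOrder K B 0 :=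
  ⟨b, rfl⟩

theorem diffOpOrder_le_succ (l : ℕ) : diffOpOrder K B l ≤ diffOpOrder K B (l + 1) := by
  induction l with
  | zero =>
    rintro _ ⟨a, rfl⟩ b
    have : Algebra.lmul K B b * (Algebra.lmul K B).toLinearMap a
        - (Algebra.lmul K B).toLinearMap a * Algebra.lmul K B b = 0 := by
      change Algebra.lmul K B b * Algebra.lmul K B a - Algebra.lmul K B a * Algebra.lmul K B b = 0
      rw [← map_mul, ← map_mul, mul_comm, sub_self]
    rw [this]
    exact Submodule.zero_mem _
  | succ l ih => exact fun u hu b => ih (hu b)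

theorem diffOpOrder_mono : Monotone (diffOpOrder K B) :=
  monotone_nat_of_le_succ diffOpOrder_le_succ

theorem mul_mem_diffOpOrder {k l : ℕ} {u v : Module.End K B}
    (hu : u ∈ diffOpOrder K B k) (hv : v ∈ diffOpOrder K B l) :
    u * v ∈ diffOpOrder K B (k + l) := by
  have key : ∀ s k l : ℕ, k + l = s → ∀ u v : Module.End K B, u ∈ diffOpOrder K B k →
      v ∈ diffOpOrder K B l → u * v ∈ diffOpOrder K B s := by
    intro s
    induction s with
    | zero =>
      intro k l h u v hu hv
      obtain ⟨rfl, rfl⟩ : k = 0 ∧ l = 0 := by omega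
      obtain ⟨a, rfl⟩ := hu
      obtain ⟨b, rfl⟩ := hv
      exact ⟨a * b, map_mul (Algebra.lmul K B) a b⟩
    | succ s ih =>
      intro k l h u v hu hv b
      have e : Algebra.lmul K B b * (u * v) - u * v * Algebra.lmul K B b
          = (Algebra.lmul K B b * u - u * Algebra.lmul K B b) * v
            + u * (Algebra.lmul K B b * v - v * Algebra.lmul K B b) := by
        rw [sub_mul, mul_sub, mul_assoc, mul_assoc, mul_assoc]
        abel
      rw [e]
      refine Submodule.add_mem _ ?_ ?_
      · cases k with
        | zero =>
          obtain ⟨a, rfl⟩ := hu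
          have : Algebra.lmul K B b * (Algebra.lmul K B).toLinearMap a
              - (Algebra.lmul K B).toLinearMap a * Algebra.lmul K B b = 0 := by
            change Algebra.lmul K B b * Algebra.lmul K B a
              - Algebra.lmul K B a * Algebra.lmul K B b = 0
            rw [← map_mul, ← map_mul, mul_comm, sub_self]
          rw [this, zero_mul]
          exact Submodule.zero_mem _
        | succ k => exact ih k l (by omega) _ _ (hu b) hv
      · cases l with
        | zero =>
          obtain ⟨a, rfl⟩ := hv
          have : Algebra.lmul K B b * (Algebra.lmul K B).toLinearMap a
              - (Algebra.lmul K B).toLinearMap a * Algebra.lmul K B b = 0 := by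
            change Algebra.lmul K B b * Algebra.lmul K B a
              - Algebra.lmul K B a * Algebra.lmul K B b = 0
            rw [← map_mul, ← map_mul, mul_comm, sub_self]
          rw [this, mul_zero]
          exact Submodule.zero_mem _
        | succ l => exact ih k l (by omega) _ _ hu (hv b)
  exact key _ _ _ rfl u v hu hv

variable (K B)

/-- The ring `𝒟(B)` of `K`-linear differential operators on `B`, the union of the order
filtration, as a subalgebra of `End_K(B)`. -/
def diffOp : Subalgebra K (Module.End K B) where
  carrier := {u | ∃ l : ℕ, u ∈ diffOpOrder K B l}
  mul_mem' := by
    rintro u v ⟨k, hu⟩ ⟨l, hv⟩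
    exact ⟨k + l, mul_mem_diffOpOrder hu hv⟩
  add_mem' := by
    rintro u v ⟨k, hu⟩ ⟨l, hv⟩
    exact ⟨max k l, Submodule.add_mem _ (diffOpOrder_mono (le_max_left k l) hu)
      (diffOpOrder_mono (le_max_right k l) hv)⟩
  algebraMap_mem' := by
    intro c
    refine ⟨0, algebraMap K B c, ?_⟩
    exact (Algebra.lmul K B).commutes c

variable {K B}

/-- `M = ⨁ᵢ B eᵢ` inside `End_K(B)`, each `B eᵢ` being free of rank one on `eᵢ`: every element of
`M` is `∑ aᵢ eᵢ` for exactly one finitely supported family `a` in `B`, and all such sums lie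
in `M`. -/
def IsLeftFreeOn {ι : Type*} (M : Set (Module.End K B)) (e : ι → Module.End K B) : Prop :=
  Set.BijOn (fun a : ι →₀ B => a.sum fun i b => Algebra.lmul K B b * e i) Set.univ M

/-- `M = ⨁ᵢ eᵢ B` inside `End_K(B)`, each `eᵢ B` being free of rank one on `eᵢ`; here the element
`b` of `B` acts on the right by composition with the multiplication by `b`. -/
def IsRightFreeOn {ι : Type*} (M : Set (Module.End K B)) (e : ι → Module.End K B) : Prop :=
  Set.BijOn (fun a : ι →₀ B => a.sum fun i b => e i * Algebra.lmul K B b) Set.univ M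

end Operators

/-! ### Higher derivations -/

section Higher

/-- A higher (Hasse-Schmidt) derivation of the `K`-algebra `B`. -/
@[ext]
structure HigherDerivation (K B : Type*) [CommRing K] [CommRing B] [Algebra K B] where
  /-- the components `δ₀, δ₁, δ₂, …` -/
  comp : ℕ → Module.End K B
  comp_zero : comp 0 = 1
  leibniz : ∀ (k : ℕ) (a b : B),
    comp k (a * b) = ∑ q ∈ Finset.HasAntidiagonal.antidiagonal k, comp q.1 a * comp q.2 b

variable {K B : Type*} [CommRing K] [CommRing B] [Algebra K B]

/-- A higher derivation is iterative if `δₖ δₗ = (k + l choose k) δₖ₊ₗ`. -/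
def HigherDerivation.IsIterative (δ : HigherDerivation K B) : Prop :=
  ∀ k l : ℕ, δ.comp k * δ.comp l = (k + l).choose k • δ.comp (k + l)

/-- On the subalgebra `K[y₁, …, yₛ]` of `B`, the component `δₖ` is the divided power
`(∂/∂y_ν)ᵏ / k!`, that is `y^α ↦ (α_ν choose k) y^(α - k e_ν)`. (If `α_ν < k` the binomial
coefficient vanishes, so the truncated subtraction does no harm.) -/
def HigherDerivation.ExtendsDividedPowers {s : ℕ} (δ : HigherDerivation K B) (y : Fin s → B)
    (ν : Fin s) : Prop :=
  ∀ (k : ℕ) (α : Fin s → ℕ),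
    δ.comp k (∏ μ, y μ ^ α μ) =
      (α ν).choose k • ∏ μ, y μ ^ (if μ = ν then α μ - k else α μ)

/-- The iterative higher derivation `δ` is attached to the derivation `D` of `B`, which is
`∂/∂y_ν` in the coordinates `y₁, …, yₛ`: its first component is `D`, and on `K[y₁, …, yₛ]` it
consists of the divided powers of `∂/∂y_ν`. -/
structure HigherDerivation.IsAttachedTo {s : ℕ} (δ : HigherDerivation K B)
    (D : Derivation K B B) (y : Fin s → B) (ν : Fin s) : Prop where
  iterative : δ.IsIterative
  comp_one : δ.comp 1 = (D : B →ₗ[K] B)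
  extends_dividedPowers : δ.ExtendsDividedPowers y ν

/-- The product `δ₁^[k₁] ⋯ δₛ^[kₛ]` in `End_K(B)`. -/
def monomialOp {s : ℕ} (δ : Fin s → HigherDerivation K B) (k : Fin s → ℕ) : Module.End K B :=
  (List.ofFn fun ν => (δ ν).comp (k ν)).prod

end Higher

/-! ### Jacobi matrix, minors and the associated derivations -/

section Jacobi

variable {K : Type*} [Field K] {m n : ℕ} (f : Fin m → MvPolynomial (Fin n) K)
  (A : Type*) [CommRing A] [Algebra (MvPolynomial (Fin n) K ⧸ Ideal.span (Set.range f)) A]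

/-- The homomorphism `K[x₁, …, xₙ] → A`, where `A` is an algebra over
`K[x₁, …, xₙ] / (f₁, …, fₘ)`. -/
def bar : MvPolynomial (Fin n) K →+* A :=
  (algebraMap (MvPolynomial (Fin n) K ⧸ Ideal.span (Set.range f)) A).comp
    (Ideal.Quotient.mk (Ideal.span (Set.range f)))

/-- The Jacobi matrix `(∂fᵢ/∂xⱼ)` with entries in `A`. -/
def jacobiMatrix : Matrix (Fin m) (Fin n) A :=
  Matrix.of fun i j => bar f A (MvPolynomial.pderiv j (f i))

/-- The minor `Δ(i, j)` of the Jacobi matrix. -/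
def jacobiMinor {r : ℕ} (i : Fin r → Fin m) (j : Fin r → Fin n) : A :=
  ((jacobiMatrix f A).submatrix i j).det

/-- The value at (the class of) the polynomial `g` of the derivation `∂_{i; j₁, …, jᵣ, j'}`: the
determinant of the `(r+1) × (r+1)` matrix whose first `r` rows are the rows `i₁, …, iᵣ` of the
Jacobi matrix, restricted to the columns `j₁, …, jᵣ, j'`, and whose last row is
`∂g/∂x_{j₁}, …, ∂g/∂x_{jᵣ}, ∂g/∂x_{j'}`. -/
def minorDerivValue {r : ℕ} (i : Fin r → Fin m) (j : Fin r → Fin n) (j' : Fin n)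
    (g : MvPolynomial (Fin n) K) : A :=
  Matrix.det (Matrix.of fun a b : Fin (r + 1) =>
    Fin.lastCases (motive := fun _ => A)
      (bar f A (MvPolynomial.pderiv (Fin.snoc (α := fun _ => Fin n) j j' b) g))
      (fun a' => jacobiMatrix f A (i a') (Fin.snoc (α := fun _ => Fin n) j j' b)) a)

/-- `D` is the derivation `∂_{i; j₁, …, jᵣ, j'}` on the `A`-algebra `B`. If `B` is a localization
of `A`, and `A` one of `K[x₁, …, xₙ] / (f₁, …, fₘ)`, this determines `D`. -/
def IsMinorDerivation {B : Type*} [CommRing B] [Algebra K B] [Algebra A B]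
    {r : ℕ} (i : Fin r → Fin m) (j : Fin r → Fin n) (j' : Fin n) (D : Derivation K B B) : Prop :=
  ∀ g : MvPolynomial (Fin n) K,
    D (algebraMap A B (bar f A g)) = algebraMap A B (minorDerivValue f A i j j' g)

end Jacobi

end

end DiffOps

open DiffOps

/-! Write B for the localization of A at Δ, and y for the coordinates outside the chosen columns.
The theorem reduces to one fact: y is a p-basis of B, that is, for every e the ring B is free over
its subring of p^e-th powers on the monomials in y with exponents below p^e.

Freeness has two halves. The derivations Δ⁻¹∂ are dual to y and kill p-th powers. Differentiating a
relation among monomials lowers its degree, which gives independence at e = 1, and iteration gives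
it for all e (`IsPBasis.of_derivations`). For generation, let E be generated by y over the p^e-th
powers; it contains K because K is perfect. The relations f = 0 and the invertible minor Δ force
every E-derivation of B to vanish, so B is unramified over E. It is also purely inseparable and of
finite type over E, so it equals E (`adjoin_frobenius_range_eq_top`).

In characteristic p an operator of order less than p^e is linear over p^e-th powers
(`frobLinear_of_mem_diffOpOrder`). It is therefore determined by its values on monomials in y, and
identities between operators become identities of binomial coefficients. Perfectness of K makes the
maps defined by such values K-linear, so the divided powers δ^[k] exist on B.

Freeness of the operators is triangularity: δ^[k] sends y^α to 1 if α = k and to 0 for every other α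
of degree at most |k|, while an operator of order at most l vanishing on all monomials of degree at
most l is zero. Left freeness transfers to the right because commutators with B lower the order.

For simplicity, taking commutators puts a nonzero multiplication into any nonzero two-sided ideal.
The elements of B it contains form an ideal stable under all δ^[k], and such an ideal is 0 or B by
`IsPBasis.ideal_eq_bot_or_top`, through Krull's intersection theorem. Non-maximality of I enters
only to ensure that y is nonempty; then the commutator of bδ^[1] with a coordinate recovers each b
in B. -/

namespace DiffOps

open Finset

noncomputable section

/-! ### Linearity of differential operators over p^e-th powers -/

section General

variable {K B : Type*} [CommRing K] [CommRing B] [Algebra K B]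

theorem lmul_apply' (a b : B) : Algebra.lmul K B a b = a * b := rfl

theorem mem_diffOpOrder_zero_iff {u : Module.End K B} :
    u ∈ diffOpOrder K B 0 ↔ u = Algebra.lmul K B (u 1) := by
  constructor
  · rintro ⟨a, rfl⟩
    ext b
    simp
  · intro h
    exact ⟨u 1, h.symm⟩

/-- A map is Frobenius-linear of height `e` if it is linear over the `p ^ e`-th powers. -/
def FrobLinear (p e : ℕ) (u : Module.End K B) : Prop :=
  ∀ c b : B, u (c ^ p ^ e * b) = c ^ p ^ e * u b

namespace FrobLinear

variable {p e : ℕ} {u v : Module.End K B}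

theorem mono {e' : ℕ} (h : e ≤ e') (hu : FrobLinear p e u) : FrobLinear p e' u := by
  intro c b
  obtain ⟨d, rfl⟩ := Nat.exists_eq_add_of_le h
  have : c ^ p ^ (e + d) = (c ^ p ^ d) ^ p ^ e := by
    rw [← pow_mul, ← pow_add, add_comm]
  rw [this, hu]

theorem add (hu : FrobLinear p e u) (hv : FrobLinear p e v) : FrobLinear p e (u + v) := by
  intro c b
  rw [LinearMap.add_apply, LinearMap.add_apply, hu, hv, mul_add]

theorem mul (hu : FrobLinear p e u) (hv : FrobLinear p e v) : FrobLinear p e (u * v) := by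
  intro c b
  rw [Module.End.mul_apply, Module.End.mul_apply, hv, hu]

theorem lmul (b : B) : FrobLinear p e (Algebra.lmul K B b) := by
  intro c d
  simp only [lmul_apply']
  ring

theorem nsmul (n : ℕ) (hu : FrobLinear p e u) : FrobLinear p e (n • u) := by
  intro c b
  rw [LinearMap.smul_apply, LinearMap.smul_apply, hu, mul_smul_comm]

theorem zero : FrobLinear p e (0 : Module.End K B) := by
  intro c b
  simp

theorem sum {ι : Type*} (t : Finset ι) {w : ι → Module.End K B}
    (h : ∀ x ∈ t, FrobLinear p e (w x)) : FrobLinear p e (∑ x ∈ t, w x) := by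
  classical
  induction t using Finset.induction_on with
  | empty => simpa using zero
  | insert a t ha ih =>
    rw [Finset.sum_insert ha]
    exact (h _ (by simp)).add (ih fun x hx => h x (by simp [hx]))

end FrobLinear

theorem iterate_commutator_mem (b : B) (l : ℕ) (u : Module.End K B) (hu : u ∈ diffOpOrder K B l) :
    ((LinearMap.mulLeft K (Algebra.lmul K B b) - LinearMap.mulRight K (Algebra.lmul K B b)) ^
      (l + 1)) u = 0 := by
  induction l generalizing u with
  | zero =>
    obtain ⟨a, rfl⟩ := hu
    ext x
    simp only [zero_add, pow_one, LinearMap.sub_apply, LinearMap.mulLeft_apply,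
      LinearMap.mulRight_apply, Module.End.mul_apply, AlgHom.toLinearMap_apply, lmul_apply',
      LinearMap.zero_apply]
    ring
  | succ l ih =>
    rw [pow_succ, Module.End.mul_apply]
    exact ih _ (hu b)

/-- Left and right multiplication by c commute, so in characteristic p the p^e-th power of ad(c) is
ad(c^(p^e)). Each application of ad(c) lowers the order, so this power kills `u`. -/
theorem frobLinear_of_mem_diffOpOrder {p : ℕ} [Fact p.Prime] [CharP B p] {e l : ℕ}
    (hl : l < p ^ e) {u : Module.End K B} (hu : u ∈ diffOpOrder K B l) : FrobLinear p e u := by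
  have hp : (p : Module.End K (Module.End K B)) = 0 := by
    ext u b
    simp [Module.End.natCast_apply, CharP.cast_eq_zero]
  have h0 : ∀ b : B, ((LinearMap.mulLeft K (Algebra.lmul K B b)
      - LinearMap.mulRight K (Algebra.lmul K B b)) ^ (p ^ e)) u = 0 := by
    intro b
    obtain ⟨d, hd⟩ := Nat.exists_eq_add_of_lt hl
    rw [hd, show l + d + 1 = d + (l + 1) by ring, pow_add, Module.End.mul_apply,
      iterate_commutator_mem b l u hu, map_zero]
  -- Characteristic p is deduced from p = 0 only in a nontrivial ring; in the trivial case `u` is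
  -- zero.
  rcases subsingleton_or_nontrivial (Module.End K (Module.End K B)) with hs | hn
  · intro c b
    have h1 : (1 : Module.End K (Module.End K B)) u = (0 : Module.End K (Module.End K B)) u := by
      rw [Subsingleton.elim (1 : Module.End K (Module.End K B)) 0]
    have h2 : u = 0 := h1
    simp [h2]
  have : CharP (Module.End K (Module.End K B)) p :=
    (CharP.charP_iff_prime_eq_zero Fact.out).2 hp
  intro c b
  have h := h0 c
  have hc : Commute (LinearMap.mulLeft K (Algebra.lmul K B c))
      (LinearMap.mulRight K (Algebra.lmul K B c)) := LinearMap.commute_mulLeft_right _ _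
  have hpow := sub_pow_char_pow_of_commute (R := Module.End K (Module.End K B)) p e hc
  rw [hpow, LinearMap.pow_mulLeft, LinearMap.pow_mulRight, ← map_pow] at h
  have h2 := LinearMap.congr_fun h b
  simp only [LinearMap.sub_apply, LinearMap.mulLeft_apply, LinearMap.mulRight_apply,
    Module.End.mul_apply, lmul_apply', LinearMap.zero_apply] at h2
  exact (sub_eq_zero.1 h2).symm

namespace HigherDerivation

theorem comp_mul_lmul (δ : HigherDerivation K B) (k : ℕ) (b : B) :
    δ.comp k * Algebra.lmul K B b =
      ∑ q ∈ antidiagonal k, Algebra.lmul K B (δ.comp q.1 b) * δ.comp q.2 := by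
  ext x
  simp [δ.leibniz]

/-- By the Leibniz rule the leading term of δₖb is bδₖ, which the commutator cancels; the remaining
terms involve only components of lower index. -/
theorem comp_mem_diffOpOrder (δ : HigherDerivation K B) (k : ℕ) :
    δ.comp k ∈ diffOpOrder K B k := by
  induction k using Nat.strong_induction_on with
  | _ k ih =>
    cases k with
    | zero =>
      rw [δ.comp_zero]
      exact ⟨1, map_one (Algebra.lmul K B)⟩
    | succ k =>
      intro b
      rw [comp_mul_lmul, Nat.antidiagonal_succ, sum_cons, δ.comp_zero, Module.End.one_apply,
        sub_add_cancel_left]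
      refine Submodule.neg_mem _ (Submodule.sum_mem _ fun q hq => ?_)
      obtain ⟨q', hq', rfl⟩ := mem_map.1 hq
      have hk : q'.2 ≤ k := by
        have := mem_antidiagonal.1 hq'
        omega
      have := mul_mem_diffOpOrder (lmul_mem_diffOpOrder_zero (K := K) (δ.comp (q'.1 + 1) b))
        (ih q'.2 (by omega))
      rw [zero_add] at this
      exact diffOpOrder_mono hk this

end HigherDerivation

end General

end

end DiffOps

namespace DiffOps

open Finset

noncomputable section

/-! ### p-bases from dual derivations -/

section PBasis

variable {B : Type*} [CommRing B] {s : ℕ}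

/-- The elements `y₁, …, yₛ` of the ring `B` form a `p`-basis: for every `e`, each element of `B`
is in exactly one way a combination of the monomials with exponents less than `p ^ e` whose
coefficients are `p ^ e`-th powers. -/
def IsPBasis (p : ℕ) (y : Fin s → B) : Prop :=
  ∀ e : ℕ, ∀ b : B, ∃! c : (Fin s → Fin (p ^ e)) → B,
    ∑ α, c α ^ p ^ e * ∏ ν, y ν ^ (α ν : ℕ) = b

variable {p : ℕ} [Fact p.Prime] [CharP B p]

/-- Each exponent below p^(e+1) is β + pα with β < p and α < p^e. A relation at height e + 1 thus
becomes one at height 1 whose coefficients are sums at height e. -/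
theorem sum_monomials_succ (y : Fin s → B) (e : ℕ)
    (c : (Fin s → Fin (p ^ e * p)) → B) :
    ∑ γ : Fin s → Fin (p ^ e * p), c γ ^ p ^ (e + 1) * ∏ ν, y ν ^ (γ ν : ℕ) =
      ∑ β : Fin s → Fin p, (∑ α : Fin s → Fin (p ^ e),
        c (fun ν => finProdFinEquiv (α ν, β ν)) ^ p ^ e * ∏ ν, y ν ^ (α ν : ℕ)) ^ p *
          ∏ ν, y ν ^ (β ν : ℕ) := by
  have h : ∀ β : Fin s → Fin p, (∑ α : Fin s → Fin (p ^ e),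
        c (fun ν => finProdFinEquiv (α ν, β ν)) ^ p ^ e * ∏ ν, y ν ^ (α ν : ℕ)) ^ p *
          ∏ ν, y ν ^ (β ν : ℕ) = ∑ α : Fin s → Fin (p ^ e),
        c (fun ν => finProdFinEquiv (α ν, β ν)) ^ p ^ (e + 1) *
          ∏ ν, y ν ^ ((finProdFinEquiv (α ν, β ν) : Fin _) : ℕ) := by
    intro β
    rw [sum_pow_char, sum_mul]
    refine sum_congr rfl fun α _ => ?_
    rw [mul_pow, ← pow_mul, pow_succ p e, mul_assoc, ← prod_pow, ← prod_mul_distrib]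
    congr 1
    refine prod_congr rfl fun ν _ => ?_
    rw [← pow_mul, ← pow_add, finProdFinEquiv_apply_val]
    congr 1
    ring
  simp_rw [h]
  rw [← Fintype.sum_prod_type']
  symm
  refine Fintype.sum_equiv ((Equiv.prodComm _ _).trans
    ((Equiv.arrowProdEquivProdArrow (Fin s) (fun _ => Fin (p ^ e)) (fun _ => Fin p)).symm.trans
    (Equiv.piCongrRight fun _ => finProdFinEquiv))) _ _ fun x => ?_
  rfl

/-- Evaluation at `y` of the polynomial with coefficients raised to the power `p`. -/
abbrev frobEval (p : ℕ) [Fact p.Prime] [CharP B p] (y : Fin s → B) : MvPolynomial (Fin s) B →+* B :=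
  MvPolynomial.eval₂Hom (frobenius B p) y

/-- Derivations kill p-th powers, so only the monomials in `y` are differentiated. -/
theorem derivation_frobEval {K : Type*} [CommRing K] [Algebra K B] (y : Fin s → B) (ν : Fin s)
    (D : Derivation K B B) (hD : ∀ μ, D (y μ) = if μ = ν then 1 else 0)
    (Q : MvPolynomial (Fin s) B) :
    D (frobEval p y Q) = frobEval p y (MvPolynomial.pderiv ν Q) := by
  induction Q using MvPolynomial.induction_on with
  | C a => simp [frobenius_def, Derivation.leibniz_pow]
  | add P Q hP hQ => rw [map_add, map_add, map_add, map_add, hP, hQ]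
  | mul_X P μ hP =>
    rw [map_mul, Derivation.leibniz, hP, Derivation.leibniz, map_add]
    simp only [smul_eq_mul, map_mul]
    congr 2
    simp only [MvPolynomial.coe_eval₂Hom, MvPolynomial.eval₂_X, hD, MvPolynomial.pderiv_X]
    rcases eq_or_ne μ ν with rfl | h
    · simp
    · simp [h]

/-- The partial derivatives of a relation are relations of smaller degree, hence zero by induction.
Exponents below p are invertible or zero in B, so only a constant survives, and its p-th power is
zero. -/
theorem eq_zero_of_frobEval_eq_zero [IsDomain B] {K : Type*} [CommRing K] [Algebra K B]
    (y : Fin s → B) (D : Fin s → Derivation K B B)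
    (hD : ∀ ν μ, D ν (y μ) = if μ = ν then 1 else 0) (N : ℕ) (Q : MvPolynomial (Fin s) B)
    (hQ : ∀ α ∈ Q.support, ∀ ν, α ν < p) (hN : ∀ α ∈ Q.support, α.degree ≤ N)
    (h : frobEval p y Q = 0) : Q = 0 := by
  induction N generalizing Q with
  | zero =>
    have hC : Q = MvPolynomial.C (Q.coeff 0) := by
      ext α
      rw [MvPolynomial.coeff_C]
      split_ifs with h0
      · rw [h0]
      · by_contra h1
        have := hN α (MvPolynomial.mem_support_iff.2 h1)
        exact h0 ((Finsupp.degree_eq_zero_iff _).1 (Nat.le_zero.1 this)).symm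
    rw [hC] at h ⊢
    have h1 : Q.coeff 0 ^ p = 0 := by simpa [frobenius_def] using h
    rw [eq_zero_of_pow_eq_zero h1, map_zero]
  | succ N ih =>
    have hder : ∀ ν, MvPolynomial.pderiv ν Q = 0 := by
      intro ν
      have key : ∀ α ∈ (MvPolynomial.pderiv ν Q).support, α + Finsupp.single ν 1 ∈ Q.support := by
        intro α hα
        rw [MvPolynomial.mem_support_iff, MvPolynomial.coeff_pderiv] at hα
        rw [MvPolynomial.mem_support_iff]
        exact fun h0 => hα (by rw [h0]; simp)
      refine ih _ ?_ ?_ ?_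
      · intro α hα μ
        have := hQ _ (key α hα) μ
        rw [Finsupp.add_apply] at this
        omega
      · intro α hα
        have := hN _ (key α hα)
        rw [map_add, Finsupp.degree_single] at this
        omega
      · rw [← derivation_frobEval y ν (D ν) (hD ν), h, map_zero]
    refine ih Q hQ ?_ h
    intro α hα
    suffices α = 0 by simp [this]
    ext ν
    by_contra h0
    have h0' : α ν ≠ 0 := h0
    have h1 := congrArg (MvPolynomial.coeff (α - Finsupp.single ν 1)) (hder ν)
    have h2 : α - Finsupp.single ν 1 + Finsupp.single ν 1 = α :=
      tsub_add_cancel_of_le (Finsupp.single_le_iff.2 (Nat.one_le_iff_ne_zero.2 h0'))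
    rw [MvPolynomial.coeff_pderiv, h2, MvPolynomial.coeff_zero] at h1
    have h3 : (((α - Finsupp.single ν 1 : Fin s →₀ ℕ) ν : ℕ) : B) + 1 = ((α ν : ℕ) : B) := by
      have h4 : (α - Finsupp.single ν 1 : Fin s →₀ ℕ) ν + 1 = α ν := by
        simp
        omega
      exact_mod_cast congrArg (Nat.cast : ℕ → B) h4
    rw [h3] at h1
    rcases mul_eq_zero.1 h1 with h4 | h4
    · exact MvPolynomial.mem_support_iff.1 hα h4
    · exact Nat.not_dvd_of_pos_of_lt (Nat.pos_of_ne_zero h0') (hQ α hα ν)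
        ((CharP.cast_eq_zero_iff B p _).1 h4)

theorem eq_zero_of_sum_monomials_eq_zero [IsDomain B] {K : Type*} [CommRing K] [Algebra K B]
    (y : Fin s → B) (D : Fin s → Derivation K B B)
    (hD : ∀ ν μ, D ν (y μ) = if μ = ν then 1 else 0)
    (c : (Fin s → Fin p) → B) (h : ∑ α, c α ^ p * ∏ ν, y ν ^ (α ν : ℕ) = 0) : c = 0 := by
  let ex : (Fin s → Fin p) → (Fin s →₀ ℕ) := fun α =>
    Finsupp.equivFunOnFinite.symm fun ν => (α ν : ℕ)
  have hex : Function.Injective ex := by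
    intro α β hab
    funext ν
    exact Fin.ext (DFunLike.congr_fun hab ν)
  set Q : MvPolynomial (Fin s) B := ∑ α, MvPolynomial.monomial (ex α) (c α) with hQ
  have hcoeff : ∀ α, Q.coeff (ex α) = c α := by
    intro α
    rw [hQ, MvPolynomial.coeff_sum]
    simp [MvPolynomial.coeff_monomial, hex.eq_iff]
  have hsupp : ∀ α ∈ Q.support, ∃ β, α = ex β := by
    intro α hα
    by_contra hne
    push Not at hne
    rw [MvPolynomial.mem_support_iff, hQ, MvPolynomial.coeff_sum] at hα
    refine hα (sum_eq_zero fun β _ => ?_)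
    rw [MvPolynomial.coeff_monomial, if_neg (hne β).symm]
  have h0 : Q = 0 := by
    refine eq_zero_of_frobEval_eq_zero (p := p) y D hD (Q.support.sup Finsupp.degree) Q ?_ ?_ ?_
    · intro α hα ν
      obtain ⟨β, rfl⟩ := hsupp α hα
      exact (β ν).2
    · exact fun α hα => Finset.le_sup (f := Finsupp.degree) hα
    · rw [← h, hQ, map_sum]
      refine sum_congr rfl fun α _ => ?_
      simp only [MvPolynomial.coe_eval₂Hom, MvPolynomial.eval₂_monomial, frobenius_def]
      rw [Finsupp.prod_fintype _ _ (by simp)]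
      rfl
  funext α
  rw [← hcoeff, h0]
  simp

theorem eq_zero_of_sum_monomials_pow_eq_zero [IsDomain B] (y : Fin s → B)
    (h₁ : ∀ c : (Fin s → Fin p) → B, ∑ α, c α ^ p * ∏ ν, y ν ^ (α ν : ℕ) = 0 → c = 0)
    (e : ℕ) (c : (Fin s → Fin (p ^ e)) → B)
    (h : ∑ α, c α ^ p ^ e * ∏ ν, y ν ^ (α ν : ℕ) = 0) : c = 0 := by
  induction e with
  | zero =>
    have hv : ∀ α : Fin s → Fin (p ^ 0), ∀ ν, (α ν : ℕ) = 0 := fun α ν => by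
      have := (α ν).2
      simpa using this
    have : Unique (Fin s → Fin (p ^ 0)) :=
      { default := fun _ => ⟨0, by simp⟩
        uniq := fun α => funext fun ν => Fin.ext (hv α ν) }
    rw [Fintype.sum_unique] at h
    simp only [hv, pow_zero, prod_const_one, mul_one, pow_one] at h
    funext α
    exact (congrArg c (Subsingleton.elim α _)).trans h
  | succ e ih =>
    change (Fin s → Fin (p ^ e * p)) → B at c
    have h' := (sum_monomials_succ y e c).symm.trans h
    have h2 := h₁ _ h'
    funext γ
    have h3 := congrFun (ih _ (congrFun h2 fun ν => (finProdFinEquiv.symm (γ ν)).2))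
      fun ν => (finProdFinEquiv.symm (γ ν)).1
    simp only [Prod.mk.eta, Equiv.apply_symm_apply] at h3
    exact h3

/-- Uniqueness of the coefficients comes from the dual derivations, existence from `hgen`. -/
theorem IsPBasis.of_derivations [IsDomain B] {K : Type*} [CommRing K] [Algebra K B]
    (y : Fin s → B) (D : Fin s → Derivation K B B)
    (hD : ∀ ν μ, D ν (y μ) = if μ = ν then 1 else 0)
    (hgen : ∀ e : ℕ, Algebra.adjoin (iterateFrobenius B p e).range (Set.range y) = ⊤) :
    IsPBasis p y := by
  intro e b
  have hinj : ∀ c c' : (Fin s → Fin (p ^ e)) → B,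
      ∑ α, c α ^ p ^ e * ∏ ν, y ν ^ (α ν : ℕ) = ∑ α, c' α ^ p ^ e * ∏ ν, y ν ^ (α ν : ℕ) →
        c = c' := by
    intro c c' h
    rw [← sub_eq_zero]
    refine eq_zero_of_sum_monomials_pow_eq_zero y (eq_zero_of_sum_monomials_eq_zero y D hD) e _ ?_
    rw [← sub_eq_zero, ← sum_sub_distrib] at h
    rw [← h]
    refine sum_congr rfl fun α _ => ?_
    rw [Pi.sub_apply, sub_pow_char_pow, sub_mul]
  suffices hex : ∃ c : (Fin s → Fin (p ^ e)) → B,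
      ∑ α, c α ^ p ^ e * ∏ ν, y ν ^ (α ν : ℕ) = b by
    obtain ⟨c, hc⟩ := hex
    exact ⟨c, hc, fun c' hc' => hinj _ _ (hc'.trans hc.symm)⟩
  have hpos : 0 < p ^ e := pow_pos (Fact.out : p.Prime).pos e
  have hb : b ∈ Submodule.span (iterateFrobenius B p e).range
      (Submonoid.closure (Set.range y) : Set B) := by
    rw [← Algebra.adjoin_eq_span, hgen e]
    trivial
  induction hb using Submodule.span_induction with
  | mem b hb =>
    have hmon : ∃ α : Fin s → ℕ, b = ∏ ν, y ν ^ α ν := by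
      refine Submonoid.closure_induction ?_ ?_ ?_ hb
      · rintro _ ⟨ν, rfl⟩
        refine ⟨Pi.single ν 1, ?_⟩
        rw [prod_eq_single ν (fun μ _ hμ => by simp [hμ]) (by simp)]
        simp
      · exact ⟨0, by simp⟩
      · rintro _ _ _ _ ⟨α, rfl⟩ ⟨β, rfl⟩
        exact ⟨α + β, by simp [pow_add, prod_mul_distrib]⟩
    obtain ⟨α, rfl⟩ := hmon
    -- Exponents are reduced modulo p^e; the quotients go into the coefficient as a p^e-th power.
    let α₀ : Fin s → Fin (p ^ e) := fun ν => ⟨α ν % p ^ e, Nat.mod_lt _ hpos⟩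
    refine ⟨Pi.single α₀ (∏ ν, y ν ^ (α ν / p ^ e)), ?_⟩
    rw [sum_eq_single α₀ (fun β _ hβ => by
        rw [Pi.single_eq_of_ne hβ, zero_pow hpos.ne', zero_mul]) (by simp), Pi.single_eq_same, ← prod_pow, ← prod_mul_distrib]
    refine prod_congr rfl fun ν _ => ?_
    rw [← pow_mul, ← pow_add, mul_comm, Nat.div_add_mod]
  | zero => exact ⟨0, sum_eq_zero fun α _ => by rw [Pi.zero_apply, zero_pow hpos.ne', zero_mul]⟩
  | add a b _ _ ha hb =>
    obtain ⟨c, rfl⟩ := ha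
    obtain ⟨c', rfl⟩ := hb
    refine ⟨c + c', ?_⟩
    rw [← sum_add_distrib]
    refine sum_congr rfl fun α _ => ?_
    rw [Pi.add_apply, add_pow_char_pow, add_mul]
  | smul a b _ hb =>
    obtain ⟨c, rfl⟩ := hb
    obtain ⟨_, a, rfl⟩ := a
    refine ⟨fun α => a * c α, ?_⟩
    rw [Subring.smul_def, smul_eq_mul, mul_sum]
    refine sum_congr rfl fun α _ => ?_
    rw [mul_pow, mul_assoc]
    rfl

end PBasis

end

end DiffOps

namespace DiffOps

open Finset

noncomputable section

/-! ### Divided powers attached to a p-basis -/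

section DividedPowers

variable {B : Type*} [CommRing B] {s : ℕ}

/-- The monomial `y₁ ^ α₁ ⋯ yₛ ^ αₛ`. -/
def mon (y : Fin s → B) (α : Fin s → ℕ) : B := ∏ ν, y ν ^ α ν

theorem mon_zero (y : Fin s → B) : mon y 0 = 1 := by
  simp [mon]

theorem mon_add (y : Fin s → B) (α β : Fin s → ℕ) : mon y (α + β) = mon y α * mon y β := by
  simp [mon, pow_add, prod_mul_distrib]

theorem mon_single (y : Fin s → B) (ν : Fin s) (k : ℕ) : mon y (Pi.single ν k) = y ν ^ k := by
  rw [mon, prod_eq_single ν (fun μ _ hμ => by simp [hμ]) (by simp)]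
  simp

theorem mon_nsmul (y : Fin s → B) (q : ℕ) (α : Fin s → ℕ) : mon y (q • α) = mon y α ^ q := by
  simp [mon, pow_mul, ← prod_pow, mul_comm q]

/-- Vandermonde's identity, together with the divisibility by p of the binomials (p^e choose i) for
0 < i < p^e. It makes the divided-power formula compatible with linearity over p^e-th powers. -/
theorem choose_add_pow_mul_eq (B : Type*) [CommRing B] {p : ℕ} [Fact p.Prime] [CharP B p]
    {e k : ℕ} (hk : k < p ^ e) (a b : ℕ) : ((a + p ^ e * b).choose k : B) = (a.choose k : B) := by
  induction b with
  | zero => simp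
  | succ b ih =>
    rw [← ih, show a + p ^ e * (b + 1) = p ^ e + (a + p ^ e * b) by ring, Nat.add_choose_eq,
      Nat.cast_sum, sum_eq_single (0, k)]
    · simp
    · rintro ⟨i, l⟩ hil hne
      have hil' : i + l = k := mem_antidiagonal.1 hil
      have hi : i ≠ 0 := by
        rintro rfl
        exact hne (by simpa using hil')
      have hd := (Fact.out : p.Prime).dvd_choose_pow hi (n := e) (by omega)
      rw [Nat.cast_mul, (CharP.cast_eq_zero_iff B p _).2 hd, zero_mul]
    · intro h
      simp at h

variable {p : ℕ} {y : Fin s → B}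

namespace IsPBasis

variable (hy : IsPBasis p y)

/-- The `p ^ e`-th roots of the coefficients of an element with respect to the monomials with
exponents less than `p ^ e`. -/
def coeffs (e : ℕ) (b : B) : (Fin s → Fin (p ^ e)) → B := (hy e b).choose

theorem sum_coeffs (e : ℕ) (b : B) :
    ∑ α, hy.coeffs e b α ^ p ^ e * mon y (fun ν => (α ν : ℕ)) = b :=
  (hy e b).choose_spec.1

/-- The tool behind the operator identities below: they need checking on monomials only, once a
common height is known. -/
theorem ext (hy : IsPBasis p y) {K : Type*} [CommRing K] [Algebra K B] {e : ℕ} {u v : Module.End K B} (hu : FrobLinear p e u) (hv : FrobLinear p e v)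
    (h : ∀ α, u (mon y α) = v (mon y α)) : u = v := by
  ext b
  rw [← hy.sum_coeffs e b, map_sum, map_sum]
  refine sum_congr rfl fun α _ => ?_
  rw [hu, hv, h]

theorem coeffs_eq {e : ℕ} {b : B} {c : (Fin s → Fin (p ^ e)) → B}
    (h : ∑ α, c α ^ p ^ e * mon y (fun ν => (α ν : ℕ)) = b) : hy.coeffs e b = c :=
  ((hy e b).choose_spec.2 c h).symm

theorem coeffs_pow_mul (e : ℕ) (c b : B) (α : Fin s → Fin (p ^ e)) :
    hy.coeffs e (c ^ p ^ e * b) α = c * hy.coeffs e b α := by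
  refine congrFun (hy.coeffs_eq (c := fun α => c * hy.coeffs e b α) ?_) α
  conv_rhs => rw [← hy.sum_coeffs e b, mul_sum]
  refine sum_congr rfl fun α _ => ?_
  rw [mul_pow, mul_assoc]

variable [Fact p.Prime]

theorem coeffs_mon (e : ℕ) (α : Fin s → Fin (p ^ e)) :
    hy.coeffs e (mon y fun ν => (α ν : ℕ)) = Pi.single α 1 := by
  refine hy.coeffs_eq ?_
  have hpos : 0 < p ^ e := pow_pos (Fact.out : p.Prime).pos e
  rw [sum_eq_single α (fun β _ hβ => by rw [Pi.single_eq_of_ne hβ, zero_pow hpos.ne', zero_mul])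
    (by simp)]
  simp

variable [CharP B p]

theorem coeffs_add (e : ℕ) (a b : B) (α : Fin s → Fin (p ^ e)) :
    hy.coeffs e (a + b) α = hy.coeffs e a α + hy.coeffs e b α := by
  refine congrFun (hy.coeffs_eq (c := fun α => hy.coeffs e a α + hy.coeffs e b α) ?_) α
  conv_rhs => rw [← hy.sum_coeffs e a, ← hy.sum_coeffs e b, ← sum_add_distrib]
  refine sum_congr rfl fun α _ => ?_
  rw [add_pow_char_pow, add_mul]

variable {K : Type*} [Field K] [CharP K p] [PerfectRing K p] [Algebra K B]

variable (K) in
/-- The Frobenius-linear map with prescribed values on the monomials with exponents less than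
`p ^ e`. -/
def frobExtend (e : ℕ) (w : (Fin s → Fin (p ^ e)) → B) : Module.End K B where
  toFun b := ∑ α, hy.coeffs e b α ^ p ^ e * w α
  map_add' a b := by
    rw [← sum_add_distrib]
    refine sum_congr rfl fun α _ => ?_
    rw [coeffs_add, add_pow_char_pow, add_mul]
  map_smul' c b := by
    -- As K is perfect, scalars are p^e-th powers, so K-linearity is a case of Frobenius-linearity.
    have hc : algebraMap K B c = algebraMap K B ((iterateFrobeniusEquiv K p e).symm c) ^ p ^ e := by
      rw [← map_pow, ← iterateFrobeniusEquiv_def, RingEquiv.apply_symm_apply]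
    simp only [Algebra.smul_def, RingHom.id_apply, hc, mul_sum]
    refine sum_congr rfl fun α _ => ?_
    rw [coeffs_pow_mul, mul_pow, mul_assoc]

theorem frobExtend_frobLinear (e : ℕ) (w : (Fin s → Fin (p ^ e)) → B) :
    FrobLinear p e (hy.frobExtend K e w) := by
  intro c b
  simp only [frobExtend, LinearMap.coe_mk, AddHom.coe_mk, mul_sum]
  refine sum_congr rfl fun α _ => ?_
  rw [coeffs_pow_mul, mul_pow, mul_assoc]

theorem frobExtend_mon (e : ℕ) (w : (Fin s → Fin (p ^ e)) → B) (α : Fin s → Fin (p ^ e)) :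
    hy.frobExtend K e w (mon y fun ν => (α ν : ℕ)) = w α := by
  have hpos : 0 < p ^ e := pow_pos (Fact.out : p.Prime).pos e
  simp only [frobExtend, LinearMap.coe_mk, AddHom.coe_mk, coeffs_mon]
  rw [sum_eq_single α (fun β _ hβ => by rw [Pi.single_eq_of_ne hβ, zero_pow hpos.ne', zero_mul])
    (by simp)]
  simp

variable (K) in
/-- The divided power `(∂/∂y₁)^k₁ / k₁! ⋯ (∂/∂yₛ)^kₛ / kₛ!`. -/
def dividedPower (k : Fin s → ℕ) : Module.End K B :=
  hy.frobExtend K (∑ ν, k ν) fun α => ∏ ν, (((α ν : ℕ).choose (k ν) : ℕ) : B) * y ν ^ (α ν - k ν)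

theorem dividedPower_frobLinear (k : Fin s → ℕ) {e : ℕ} (he : ∑ ν, k ν ≤ e) :
    FrobLinear p e (hy.dividedPower K k) :=
  (hy.frobExtend_frobLinear _ _).mono he

/-- The values are prescribed only for exponents below p^|k|, a height sufficient because each entry
of `k` is at most |k| < p^|k|. Beyond that range the p^|k|-th powers are pulled out, and the
binomials do not change modulo p. -/
theorem dividedPower_mon (k α : Fin s → ℕ) :
    hy.dividedPower K k (mon y α) = ((∏ ν, (α ν).choose (k ν) : ℕ) : B) * mon y (α - k) := by
  set e := ∑ ν, k ν with he
  have hpos : 0 < p ^ e := pow_pos (Fact.out : p.Prime).pos e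
  have hk : ∀ ν, k ν < p ^ e := fun ν =>
    (single_le_sum (f := k) (fun _ _ => Nat.zero_le _) (mem_univ ν)).trans_lt
      (Nat.lt_pow_self (Fact.out : p.Prime).one_lt)
  let α₀ : Fin s → Fin (p ^ e) := fun ν => ⟨α ν % p ^ e, Nat.mod_lt _ hpos⟩
  have h1 : mon y α = mon y (fun ν => α ν / p ^ e) ^ p ^ e * mon y fun ν => (α₀ ν : ℕ) := by
    rw [← mon_nsmul, ← mon_add]
    congr 1
    funext ν
    simp [α₀, Nat.div_add_mod]
  rw [h1, hy.dividedPower_frobLinear k he.ge, dividedPower, hy.frobExtend_mon, mon, ← prod_pow,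
    ← prod_mul_distrib, Nat.cast_prod, mon, ← prod_mul_distrib]
  refine prod_congr rfl fun ν _ => ?_
  have h2 : α ν = α ν % p ^ e + p ^ e * (α ν / p ^ e) := (Nat.mod_add_div _ _).symm
  have h3 : ((α ν).choose (k ν) : B) = ((α ν % p ^ e).choose (k ν) : B) := by
    conv_lhs => rw [h2]
    exact choose_add_pow_mul_eq B (hk ν) _ _
  rw [h3]
  rcases lt_or_ge (α ν % p ^ e) (k ν) with h4 | h4
  · simp [α₀, Nat.choose_eq_zero_of_lt h4]
  · have h5 : (α - k) ν = (α ν % p ^ e - k ν) + (α ν / p ^ e) * p ^ e := by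
      rw [Pi.sub_apply, mul_comm]
      omega
    rw [h5, pow_add, pow_mul]
    simp only [α₀]
    ring

theorem dividedPower_single_mon (ν : Fin s) (k : ℕ) (α : Fin s → ℕ) :
    hy.dividedPower K (Pi.single ν k) (mon y α) =
      ((α ν).choose k : B) * mon y (α - Pi.single ν k) := by
  rw [dividedPower_mon, prod_eq_single ν (fun μ _ hμ => by simp [hμ]) (by simp),
    Pi.single_eq_same]

theorem dividedPower_zero : hy.dividedPower K 0 = 1 := by
  refine hy.ext (e := 0) (hy.dividedPower_frobLinear 0 (by simp)) (fun c b => rfl) fun α => ?_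
  simp [dividedPower_mon]

theorem dividedPower_mul (k l : Fin s → ℕ) :
    hy.dividedPower K k * hy.dividedPower K l =
      (∏ ν, (k ν + l ν).choose (k ν)) • hy.dividedPower K (k + l) := by
  refine hy.ext (e := ∑ ν, k ν + ∑ ν, l ν) (((hy.dividedPower_frobLinear k (by simp))).mul
    (hy.dividedPower_frobLinear l (by simp)))
    ((hy.dividedPower_frobLinear _ (by simp [sum_add_distrib])).nsmul _) fun α => ?_
  rw [Module.End.mul_apply, LinearMap.smul_apply, dividedPower_mon, dividedPower_mon,
    ← nsmul_eq_mul, map_nsmul, dividedPower_mon, nsmul_eq_mul, nsmul_eq_mul, ← mul_assoc,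
    ← mul_assoc, ← Nat.cast_mul, ← Nat.cast_mul, ← prod_mul_distrib, ← prod_mul_distrib,
    tsub_tsub, add_comm l k]
  congr 2
  refine prod_congr rfl fun ν _ => ?_
  -- The iterativity relation is C(α, l) C(α − l, k) = C(k + l, k) C(α, k + l), coordinate by
  -- coordinate.
  have h := Nat.choose_mul (n := α ν) (Nat.le_add_left (l ν) (k ν))
  rw [Nat.add_sub_cancel] at h
  rw [Pi.sub_apply, Pi.add_apply, ← h, mul_comm, Nat.choose_symm_add]

theorem dividedPower_commute (k l : Fin s → ℕ) :
    Commute (hy.dividedPower K k) (hy.dividedPower K l) := by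
  rw [commute_iff_eq, dividedPower_mul, dividedPower_mul, add_comm l k]
  congr 1
  refine prod_congr rfl fun ν _ => ?_
  rw [add_comm (l ν), Nat.choose_symm_add]

/-- On monomials the Leibniz rule is Vandermonde's identity for (α + β choose k). -/
theorem dividedPower_single_mul_lmul_mon (ν : Fin s) (k : ℕ) (β : Fin s → ℕ) :
    hy.dividedPower K (Pi.single ν k) * Algebra.lmul K B (mon y β) =
      ∑ q ∈ antidiagonal k, Algebra.lmul K B (hy.dividedPower K (Pi.single ν q.2) (mon y β)) *
        hy.dividedPower K (Pi.single ν q.1) := by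
  have hk : ∀ q ∈ antidiagonal k, q.1 ≤ k := fun q hq => by
    have := mem_antidiagonal.1 hq
    omega
  refine hy.ext (e := k) ((hy.dividedPower_frobLinear _ (by simp)).mul (.lmul _))
    (.sum _ fun q hq => (FrobLinear.lmul _).mul
      (hy.dividedPower_frobLinear _ (by simpa using hk q hq))) fun α => ?_
  rw [Module.End.mul_apply, lmul_apply', ← mon_add, LinearMap.sum_apply, dividedPower_single_mon,
    Pi.add_apply, add_comm (β ν), Nat.add_choose_eq, Nat.cast_sum, sum_mul]
  refine sum_congr rfl fun q hq => ?_
  rw [Module.End.mul_apply, lmul_apply', dividedPower_single_mon, dividedPower_single_mon]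
  rcases lt_or_ge (α ν) q.1 with h1 | h1
  · simp [Nat.choose_eq_zero_of_lt h1]
  rcases lt_or_ge (β ν) q.2 with h2 | h2
  · simp [Nat.choose_eq_zero_of_lt h2]
  have h3 : β + α - Pi.single ν k = (α - Pi.single ν q.1) + (β - Pi.single ν q.2) := by
    have := mem_antidiagonal.1 hq
    funext μ
    rcases eq_or_ne μ ν with rfl | hμ
    · simp only [Pi.sub_apply, Pi.add_apply, Pi.single_eq_same]
      omega
    · simp only [Pi.sub_apply, Pi.add_apply, Pi.single_eq_of_ne hμ]
      omega
  rw [h3, mon_add, Nat.cast_mul]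
  ring

variable (K) in
/-- The iterative higher derivation consisting of the divided powers of `∂/∂y_ν`. -/
def higherDerivation (ν : Fin s) : HigherDerivation K B where
  comp k := hy.dividedPower K (Pi.single ν k)
  comp_zero := by rw [Pi.single_zero, dividedPower_zero]
  leibniz k a b := by
    -- The Leibniz rule is freed of monomials one factor at a time: here one factor is arbitrary,
    -- and in `h2` both are.
    have h1 : ∀ (β : Fin s → ℕ) (a : B), hy.dividedPower K (Pi.single ν k) (mon y β * a) =
        ∑ q ∈ antidiagonal k, hy.dividedPower K (Pi.single ν q.1) a *
          hy.dividedPower K (Pi.single ν q.2) (mon y β) := by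
      intro β a
      have := LinearMap.congr_fun (hy.dividedPower_single_mul_lmul_mon (K := K) ν k β) a
      rw [Module.End.mul_apply, lmul_apply', LinearMap.sum_apply] at this
      rw [this]
      refine sum_congr rfl fun q _ => ?_
      rw [Module.End.mul_apply, lmul_apply', mul_comm]
    have hk : ∀ q ∈ antidiagonal k, q.2 ≤ k := fun q hq => by
      have := mem_antidiagonal.1 hq
      omega
    have h2 : hy.dividedPower K (Pi.single ν k) * Algebra.lmul K B a =
        ∑ q ∈ antidiagonal k, Algebra.lmul K B (hy.dividedPower K (Pi.single ν q.1) a) *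
          hy.dividedPower K (Pi.single ν q.2) := by
      refine hy.ext (e := k) ((hy.dividedPower_frobLinear _ (by simp)).mul (.lmul _))
        (.sum _ fun q hq => (FrobLinear.lmul _).mul
          (hy.dividedPower_frobLinear _ (by simpa using hk q hq))) fun β => ?_
      rw [Module.End.mul_apply, lmul_apply', mul_comm, h1, LinearMap.sum_apply]
      rfl
    have h3 := LinearMap.congr_fun h2 b
    rw [Module.End.mul_apply, lmul_apply', LinearMap.sum_apply] at h3
    exact h3

theorem higherDerivation_comp (ν : Fin s) (k : ℕ) :
    (hy.higherDerivation K ν).comp k = hy.dividedPower K (Pi.single ν k) := rfl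

theorem higherDerivation_isIterative (ν : Fin s) : (hy.higherDerivation K ν).IsIterative := by
  intro k l
  rw [higherDerivation_comp, higherDerivation_comp, higherDerivation_comp, dividedPower_mul,
    ← Pi.single_add, prod_eq_single ν (fun μ _ hμ => by simp [hμ]) (by simp)]
  simp

theorem higherDerivation_extendsDividedPowers (ν : Fin s) :
    (hy.higherDerivation K ν).ExtendsDividedPowers y ν := by
  intro k α
  have := hy.dividedPower_single_mon (K := K) ν k α
  rw [mon] at this
  rw [higherDerivation_comp, this, nsmul_eq_mul]
  congr 1
  refine prod_congr rfl fun μ _ => ?_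
  split_ifs with h
  · rw [h]; simp
  · simp [h]

/-- The factors have disjoint supports, so every binomial in the product rule is 1. -/
theorem monomialOp_higherDerivation (k : Fin s → ℕ) :
    monomialOp (hy.higherDerivation K) k = hy.dividedPower K k := by
  have key : ∀ l : List (Fin s), l.Nodup →
      (l.map fun ν => hy.dividedPower K (Pi.single ν (k ν))).prod =
        hy.dividedPower K fun ν => if ν ∈ l then k ν else 0 := by
    intro l hl
    induction l with
    | nil =>
      simp only [List.map_nil, List.prod_nil, List.not_mem_nil, if_false]
      exact (hy.dividedPower_zero (K := K)).symm
    | cons ν l ih =>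
      rw [List.nodup_cons] at hl
      rw [List.map_cons, List.prod_cons, ih hl.2, dividedPower_mul, prod_eq_one, one_smul]
      · congr 1
        funext μ
        rcases eq_or_ne μ ν with rfl | hμ
        · simp [hl.1]
        · simp [hμ]
      · intro μ _
        rcases eq_or_ne μ ν with rfl | hμ
        · simp [hl.1]
        · simp [hμ]
  have h := key (List.finRange s) (List.nodup_finRange s)
  simp only [List.mem_finRange, if_true] at h
  rw [monomialOp, List.ofFn_eq_map]
  exact h

end IsPBasis

end DividedPowers

end

end DiffOps

namespace DiffOps

open Finset

noncomputable section

/-! ### Freeness of the operators on the divided powers, from the left and from the right -/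

section Combinations

variable {K B : Type*} [CommRing K] [CommRing B] [Algebra K B] {ι : Type*}

/-- The sum `∑ aᵢ eᵢ` in `End_K(B)`. -/
def leftComb (e : ι → Module.End K B) : (ι →₀ B) →+ Module.End K B :=
  Finsupp.liftAddHom fun i =>
    (AddMonoidHom.mulRight (e i)).comp (Algebra.lmul K B : B →+ Module.End K B)

/-- The sum `∑ eᵢ aᵢ` in `End_K(B)`. -/
def rightComb (e : ι → Module.End K B) : (ι →₀ B) →+ Module.End K B :=
  Finsupp.liftAddHom fun i =>
    (AddMonoidHom.mulLeft (e i)).comp (Algebra.lmul K B : B →+ Module.End K B)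

theorem leftComb_apply (e : ι → Module.End K B) (a : ι →₀ B) :
    leftComb e a = a.sum fun i b => Algebra.lmul K B b * e i := rfl

theorem rightComb_apply (e : ι → Module.End K B) (a : ι →₀ B) :
    rightComb e a = a.sum fun i b => e i * Algebra.lmul K B b := rfl

theorem isLeftFreeOn_subtype {e : ι → Module.End K B} (he : Function.Injective (leftComb e))
    {P : ι → Prop} {M : Set (Module.End K B)}
    (hM : ∀ u, u ∈ M ↔ ∃ a : ι →₀ B, (∀ i ∈ a.support, P i) ∧ leftComb e a = u) :
    IsLeftFreeOn M fun i : {i // P i} => e i := by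
  have key : ∀ a : {i // P i} →₀ B, (a.sum fun i b => Algebra.lmul K B b * e i) =
      leftComb e (a.embDomain (Function.Embedding.subtype P)) := fun a => by
    rw [leftComb_apply, Finsupp.sum_embDomain]
    rfl
  refine ⟨fun a _ => ?_, fun a _ b _ hab => ?_, fun u hu => ?_⟩
  · refine (hM _).2 ⟨_, ?_, (key a).symm⟩
    intro i hi
    rw [Finsupp.support_embDomain, mem_map] at hi
    obtain ⟨j, -, rfl⟩ := hi
    exact j.2
  · exact Finsupp.embDomain_injective _ (he ((key a).symm.trans (Eq.trans hab (key b))))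
  · obtain ⟨a, ha, rfl⟩ := (hM u).1 hu
    exact ⟨a.subtypeDomain P, Set.mem_univ _, Finsupp.sum_subtypeDomain_index
      (h := fun i b => Algebra.lmul K B b * e i) ha⟩

theorem isRightFreeOn_subtype {e : ι → Module.End K B} (he : Function.Injective (rightComb e))
    {P : ι → Prop} {M : Set (Module.End K B)}
    (hM : ∀ u, u ∈ M ↔ ∃ a : ι →₀ B, (∀ i ∈ a.support, P i) ∧ rightComb e a = u) :
    IsRightFreeOn M fun i : {i // P i} => e i := by
  have key : ∀ a : {i // P i} →₀ B, (a.sum fun i b => e i * Algebra.lmul K B b) =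
      rightComb e (a.embDomain (Function.Embedding.subtype P)) := fun a => by
    rw [rightComb_apply, Finsupp.sum_embDomain]
    rfl
  refine ⟨fun a _ => ?_, fun a _ b _ hab => ?_, fun u hu => ?_⟩
  · refine (hM _).2 ⟨_, ?_, (key a).symm⟩
    intro i hi
    rw [Finsupp.support_embDomain, mem_map] at hi
    obtain ⟨j, -, rfl⟩ := hi
    exact j.2
  · exact Finsupp.embDomain_injective _ (he ((key a).symm.trans (Eq.trans hab (key b))))
  · obtain ⟨a, ha, rfl⟩ := (hM u).1 hu
    exact ⟨a.subtypeDomain P, Set.mem_univ _, Finsupp.sum_subtypeDomain_index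
      (h := fun i b => e i * Algebra.lmul K B b) ha⟩

theorem lmul_mul_mem_diffOpOrder {l : ℕ} {u : Module.End K B} (hu : u ∈ diffOpOrder K B l) (b : B) :
    Algebra.lmul K B b * u ∈ diffOpOrder K B l := by
  simpa using mul_mem_diffOpOrder (lmul_mem_diffOpOrder_zero (K := K) b) hu

theorem mul_lmul_mem_diffOpOrder {l : ℕ} {u : Module.End K B} (hu : u ∈ diffOpOrder K B l) (b : B) :
    u * Algebra.lmul K B b ∈ diffOpOrder K B l := by
  simpa using mul_mem_diffOpOrder hu (lmul_mem_diffOpOrder_zero (K := K) b)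

variable (K B) in
/-- The differential operators of order less than `l`. -/
def diffOpOrderLT : ℕ → Submodule K (Module.End K B)
  | 0 => ⊥
  | l + 1 => diffOpOrder K B l

theorem commutator_mem_diffOpOrderLT {l : ℕ} {u : Module.End K B} (hu : u ∈ diffOpOrder K B l)
    (b : B) : Algebra.lmul K B b * u - u * Algebra.lmul K B b ∈ diffOpOrderLT K B l := by
  cases l with
  | zero =>
    obtain ⟨a, rfl⟩ := hu
    refine (Submodule.mem_bot K).2 ?_
    ext x
    simp only [LinearMap.sub_apply, Module.End.mul_apply, AlgHom.toLinearMap_apply, lmul_apply',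
      LinearMap.zero_apply]
    ring
  | succ l => exact hu b

theorem monomialOp_mem_diffOpOrder {s : ℕ} (δ : Fin s → HigherDerivation K B) (k : Fin s → ℕ) :
    monomialOp δ k ∈ diffOpOrder K B (∑ ν, k ν) := by
  induction s with
  | zero =>
    have h := lmul_mem_diffOpOrder_zero (K := K) (1 : B)
    rw [map_one] at h
    simpa [monomialOp] using h
  | succ s ih =>
    rw [monomialOp, List.ofFn_succ, List.prod_cons, Fin.sum_univ_succ]
    exact mul_mem_diffOpOrder ((δ 0).comp_mem_diffOpOrder _)
      (ih (fun ν => δ ν.succ) fun ν => k ν.succ)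

theorem monomialOp_induction {s : ℕ} {δ : Fin s → HigherDerivation K B} {k : Fin s → ℕ}
    (P : Module.End K B → Prop) (h1 : P 1) (hmul : ∀ u v, P u → P v → P (u * v))
    (h : ∀ ν, P ((δ ν).comp (k ν))) : P (monomialOp δ k) := by
  rw [monomialOp]
  have : ∀ u ∈ List.ofFn fun ν => (δ ν).comp (k ν), P u := by
    intro u hu
    obtain ⟨ν, rfl⟩ := List.mem_ofFn.1 hu
    exact h ν
  generalize (List.ofFn fun ν => (δ ν).comp (k ν)) = L at this
  induction L with
  | nil => simpa using h1
  | cons u L ih =>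
    rw [List.prod_cons]
    exact hmul _ _ (this u (by simp)) (ih fun v hv => this v (by simp [hv]))

end Combinations

namespace IsPBasis

variable {B : Type*} [CommRing B] {s p : ℕ} {y : Fin s → B}
  [Fact p.Prime] [CharP B p]

/-- The commutators [y_ν, v] satisfy the same hypothesis one order lower, so they vanish by
induction. Then v commutes with all monomials and v(y^α) = y^α v(1) = 0; Frobenius-linearity carries
this from monomials to B. -/
theorem eq_zero_of_mem_diffOpOrder (hy : IsPBasis p y) {K : Type*} [CommRing K] [Algebra K B] {l : ℕ} {v : Module.End K B}
    (hv : v ∈ diffOpOrder K B l) (h : ∀ α : Fin s → ℕ, ∑ ν, α ν ≤ l → v (mon y α) = 0) :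
    v = 0 := by
  have h1 : v 1 = 0 := by
    rw [← mon_zero y]
    exact h 0 (by simp)
  induction l generalizing v with
  | zero =>
    rw [mem_diffOpOrder_zero_iff.1 hv, h1, map_zero]
  | succ l ih =>
    have hcomm : ∀ ν, Algebra.lmul K B (y ν) * v - v * Algebra.lmul K B (y ν) = 0 := by
      intro ν
      have h2 : ∀ α : Fin s → ℕ, ∑ ν, α ν ≤ l →
          (Algebra.lmul K B (y ν) * v - v * Algebra.lmul K B (y ν)) (mon y α) = 0 := by
        intro α hα
        have h3 : y ν * mon y α = mon y (Pi.single ν 1 + α) := by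
          rw [mon_add, mon_single, pow_one]
        rw [LinearMap.sub_apply, Module.End.mul_apply, Module.End.mul_apply, lmul_apply',
          lmul_apply', h3, h α (by omega), h (Pi.single ν 1 + α)
            (by simp [sum_add_distrib]; omega), mul_zero, sub_zero]
      exact ih (hv (y ν)) h2 (by rw [← mon_zero y]; exact h2 0 (by simp))
    let M : Submonoid B :=
      { carrier := {a | ∀ b, v (a * b) = a * v b}
        one_mem' := fun b => by simp
        mul_mem' := fun {a c} ha hc b => by
          rw [mul_assoc, ha, hc, mul_assoc] }
    have hM : ∀ ν, y ν ∈ M := fun ν b =>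
      (sub_eq_zero.1 (LinearMap.congr_fun (hcomm ν) b)).symm
    refine hy.ext (e := l + 1) (frobLinear_of_mem_diffOpOrder
      (Nat.lt_pow_self (Fact.out : p.Prime).one_lt) hv) FrobLinear.zero fun α => ?_
    have h2 : mon y α ∈ M := Submonoid.prod_mem _ fun ν _ => Submonoid.pow_mem _ (hM ν) _
    have h3 := h2 1
    rw [h1, mul_one, mul_zero] at h3
    rw [h3, LinearMap.zero_apply]

variable (hy : IsPBasis p y) {K : Type*} [Field K] [CharP K p] [PerfectRing K p] [Algebra K B]

theorem dividedPower_mem_diffOpOrder (k : Fin s → ℕ) :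
    hy.dividedPower K k ∈ diffOpOrder K B (∑ ν, k ν) := by
  rw [← monomialOp_higherDerivation]
  exact monomialOp_mem_diffOpOrder _ k

/-- Sharper than the height |k| of the definition: each factor has order `k ν` less than p^e. The
study of stable ideals needs all `k` with entries below p^e at the same height e. -/
theorem dividedPower_frobLinear_of_lt (k : Fin s → ℕ) {e : ℕ} (he : ∀ ν, k ν < p ^ e) :
    FrobLinear p e (hy.dividedPower K k) := by
  rw [← monomialOp_higherDerivation]
  refine monomialOp_induction _ (fun _ _ => rfl) (fun u v => FrobLinear.mul) fun ν => ?_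
  exact frobLinear_of_mem_diffOpOrder (he ν) (HigherDerivation.comp_mem_diffOpOrder _ _)

/-- Triangularity: if α ≠ k has degree at most |k|, some α_ν is less than k_ν and the binomial
vanishes. -/
theorem dividedPower_mon_of_sum_le {k α : Fin s → ℕ} (h : ∑ ν, α ν ≤ ∑ ν, k ν) :
    hy.dividedPower K k (mon y α) = if k = α then 1 else 0 := by
  rw [dividedPower_mon]
  split_ifs with hk
  · subst hk
    simp [mon_zero]
  · have : ∃ ν, α ν < k ν := by
      by_contra! hle
      refine hk (funext fun ν => ?_)
      exact ((sum_eq_sum_iff_of_le fun ν _ => hle ν).1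
        (le_antisymm (sum_le_sum fun ν _ => hle ν) h) ν (mem_univ ν))
    obtain ⟨ν, hν⟩ := this
    rw [prod_eq_zero (mem_univ ν) (Nat.choose_eq_zero_of_lt hν)]
    simp

theorem leftComb_mon (a : (Fin s → ℕ) →₀ B) (α : Fin s → ℕ) :
    leftComb (hy.dividedPower K) a (mon y α) =
      a.sum fun k b => b * hy.dividedPower K k (mon y α) := by
  rw [leftComb_apply, Finsupp.sum, LinearMap.sum_apply]
  rfl

theorem leftComb_mon_of_le {a : (Fin s → ℕ) →₀ B} {α : Fin s → ℕ}
    (h : ∀ k ∈ a.support, ∑ ν, α ν ≤ ∑ ν, k ν) :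
    leftComb (hy.dividedPower K) a (mon y α) = a α := by
  classical
  rw [leftComb_mon, Finsupp.sum, sum_congr rfl fun k hk => by
    rw [hy.dividedPower_mon_of_sum_le (h k hk)]]
  simp only [mul_ite, mul_one, mul_zero, sum_ite_eq', Finsupp.mem_support_iff, ne_eq, ite_not]
  split_ifs with h0
  · exact h0.symm
  · rfl

theorem leftComb_injective : Function.Injective (leftComb (hy.dividedPower K)) := by
  rw [injective_iff_map_eq_zero]
  intro a ha
  by_contra hne
  obtain ⟨k, hk, hmin⟩ := exists_min_image a.support (fun k => ∑ ν, k ν)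
    (Finsupp.support_nonempty_iff.2 hne)
  have := hy.leftComb_mon_of_le (K := K) hmin
  rw [ha, LinearMap.zero_apply] at this
  exact Finsupp.mem_support_iff.1 hk this.symm

/-- The triangular system is solved degree by degree: terms of degree N correct the values on
monomials of degree N without disturbing those of lower degree. -/
theorem exists_leftComb_mon_eq (u : Module.End K B) (N : ℕ) :
    ∃ a : (Fin s → ℕ) →₀ B, (∀ k ∈ a.support, ∑ ν, k ν < N) ∧
      ∀ α : Fin s → ℕ, ∑ ν, α ν < N →
        leftComb (hy.dividedPower K) a (mon y α) = u (mon y α) := by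
  classical
  induction N with
  | zero => exact ⟨0, by simp, by simp⟩
  | succ N ih =>
    obtain ⟨a, ha, hau⟩ := ih
    let b : (Fin s → ℕ) →₀ B := Finsupp.onFinset (piAntidiag univ N)
      (fun k => if ∑ ν, k ν = N then u (mon y k) - leftComb (hy.dividedPower K) a (mon y k) else 0)
      (fun k hk => by
        have : ∑ ν, k ν = N := by
          by_contra h
          simp [h] at hk
        simpa using this)
    have hb : ∀ k ∈ b.support, ∑ ν, k ν = N := by
      intro k hk
      have := Finsupp.support_onFinset_subset hk
      simpa using this
    refine ⟨a + b, fun k hk => ?_, fun α hα => ?_⟩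
    · rcases mem_union.1 (Finsupp.support_add hk) with h | h
      · exact (ha k h).trans (Nat.lt_succ_self N)
      · rw [hb k h]
        exact Nat.lt_succ_self N
    · have hbα : leftComb (hy.dividedPower K) b (mon y α) = b α :=
        hy.leftComb_mon_of_le fun k hk => by
          rw [hb k hk]
          omega
      rw [map_add, LinearMap.add_apply, hbα]
      rcases Nat.lt_succ_iff_lt_or_eq.1 hα with h | h
      · rw [hau α h, Finsupp.onFinset_apply, if_neg h.ne, add_zero]
      · rw [Finsupp.onFinset_apply, if_pos h]
        abel

theorem leftComb_mem_diffOpOrder {a : (Fin s → ℕ) →₀ B} {l : ℕ}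
    (h : ∀ k ∈ a.support, ∑ ν, k ν ≤ l) :
    leftComb (hy.dividedPower K) a ∈ diffOpOrder K B l := by
  rw [leftComb_apply]
  exact Submodule.sum_mem _ fun k hk =>
    lmul_mul_mem_diffOpOrder (diffOpOrder_mono (h k hk) (hy.dividedPower_mem_diffOpOrder k)) _

theorem rightComb_mem_diffOpOrder {a : (Fin s → ℕ) →₀ B} {l : ℕ}
    (h : ∀ k ∈ a.support, ∑ ν, k ν ≤ l) :
    rightComb (hy.dividedPower K) a ∈ diffOpOrder K B l := by
  rw [rightComb_apply]
  exact Submodule.sum_mem _ fun k hk =>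
    mul_lmul_mem_diffOpOrder (diffOpOrder_mono (h k hk) (hy.dividedPower_mem_diffOpOrder k)) _

theorem exists_leftComb_eq {N : ℕ} {u : Module.End K B} (hu : u ∈ diffOpOrderLT K B N) :
    ∃ a : (Fin s → ℕ) →₀ B, (∀ k ∈ a.support, ∑ ν, k ν < N) ∧
      leftComb (hy.dividedPower K) a = u := by
  cases N with
  | zero => exact ⟨0, by simp, by rw [map_zero, (Submodule.mem_bot K).1 hu]⟩
  | succ l =>
    obtain ⟨a, ha, hau⟩ := hy.exists_leftComb_mon_eq u (l + 1)
    refine ⟨a, ha, sub_eq_zero.1 (hy.eq_zero_of_mem_diffOpOrder (l := l) (Submodule.sub_mem _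
      (hy.leftComb_mem_diffOpOrder fun k hk => Nat.lt_succ_iff.1 (ha k hk)) hu) fun α hα => ?_)⟩
    rw [LinearMap.sub_apply, hau α (Nat.lt_succ_iff.2 hα), sub_self]

theorem leftComb_sub_rightComb_mem {a : (Fin s → ℕ) →₀ B} {N : ℕ}
    (h : ∀ k ∈ a.support, ∑ ν, k ν ≤ N) :
    leftComb (hy.dividedPower K) a - rightComb (hy.dividedPower K) a ∈ diffOpOrderLT K B N := by
  rw [leftComb_apply, rightComb_apply, Finsupp.sum, Finsupp.sum, ← sum_sub_distrib]
  exact Submodule.sum_mem _ fun k hk => commutator_mem_diffOpOrderLT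
    (diffOpOrder_mono (h k hk) (hy.dividedPower_mem_diffOpOrder k)) _

/-- If a right combination vanishes, the left one with the same coefficients has order below its top
degree. Left freeness then removes the top-degree coefficients, a contradiction. -/
theorem rightComb_injective : Function.Injective (rightComb (hy.dividedPower K)) := by
  rw [injective_iff_map_eq_zero]
  intro a ha
  by_contra hne
  obtain ⟨k, hk, hmax⟩ := exists_max_image a.support (fun k => ∑ ν, k ν)
    (Finsupp.support_nonempty_iff.2 hne)
  have h1 := hy.leftComb_sub_rightComb_mem (K := K) hmax
  rw [ha, sub_zero] at h1
  obtain ⟨b, hb, hab⟩ := hy.exists_leftComb_eq h1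
  rw [← hy.leftComb_injective hab] at hk
  exact lt_irrefl _ (hb k hk)

/-- Moving coefficients from left to right costs an operator of lower order, absorbed by induction.
-/
theorem exists_rightComb_eq {N : ℕ} {u : Module.End K B} (hu : u ∈ diffOpOrderLT K B N) :
    ∃ a : (Fin s → ℕ) →₀ B, (∀ k ∈ a.support, ∑ ν, k ν < N) ∧
      rightComb (hy.dividedPower K) a = u := by
  classical
  induction N generalizing u with
  | zero => exact ⟨0, by simp, by rw [map_zero, (Submodule.mem_bot K).1 hu]⟩
  | succ N ih =>
    obtain ⟨a, ha, rfl⟩ := hy.exists_leftComb_eq hu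
    obtain ⟨b, hb, hab⟩ := ih (hy.leftComb_sub_rightComb_mem (K := K)
      fun k hk => Nat.lt_succ_iff.1 (ha k hk))
    refine ⟨a + b, fun k hk => ?_, by rw [map_add, hab]; abel⟩
    rcases mem_union.1 (Finsupp.support_add hk) with h | h
    · exact ha k h
    · exact (hb k h).trans (Nat.lt_succ_self N)

theorem isLeftFreeOn_diffOpOrder (l : ℕ) :
    IsLeftFreeOn (diffOpOrder K B l : Set (Module.End K B))
      (fun k : {k : Fin s → ℕ // ∑ ν, k ν ≤ l} => hy.dividedPower K k) := by
  refine isLeftFreeOn_subtype hy.leftComb_injective fun u => ⟨fun hu => ?_, ?_⟩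
  · obtain ⟨a, ha, hau⟩ := hy.exists_leftComb_eq (N := l + 1) hu
    exact ⟨a, fun k hk => Nat.lt_succ_iff.1 (ha k hk), hau⟩
  · rintro ⟨a, ha, rfl⟩
    exact hy.leftComb_mem_diffOpOrder ha

theorem isRightFreeOn_diffOpOrder (l : ℕ) :
    IsRightFreeOn (diffOpOrder K B l : Set (Module.End K B))
      (fun k : {k : Fin s → ℕ // ∑ ν, k ν ≤ l} => hy.dividedPower K k) := by
  refine isRightFreeOn_subtype hy.rightComb_injective fun u => ⟨fun hu => ?_, ?_⟩
  · obtain ⟨a, ha, hau⟩ := hy.exists_rightComb_eq (N := l + 1) hu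
    exact ⟨a, fun k hk => Nat.lt_succ_iff.1 (ha k hk), hau⟩
  · rintro ⟨a, ha, rfl⟩
    exact hy.rightComb_mem_diffOpOrder ha

theorem isLeftFreeOn_diffOp :
    IsLeftFreeOn (diffOp K B : Set (Module.End K B)) (hy.dividedPower K) := by
  refine ⟨fun a _ => ?_, hy.leftComb_injective.injOn, ?_⟩
  · exact ⟨a.support.sup fun k => ∑ ν, k ν, hy.leftComb_mem_diffOpOrder fun k hk =>
      le_sup (f := fun k : Fin s → ℕ => ∑ ν, k ν) hk⟩
  · rintro u ⟨l, hu⟩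
    obtain ⟨a, -, hau⟩ := hy.exists_leftComb_eq (N := l + 1) hu
    exact ⟨a, Set.mem_univ _, hau⟩

theorem isRightFreeOn_diffOp :
    IsRightFreeOn (diffOp K B : Set (Module.End K B)) (hy.dividedPower K) := by
  refine ⟨fun a _ => ?_, hy.rightComb_injective.injOn, ?_⟩
  · exact ⟨a.support.sup fun k => ∑ ν, k ν, hy.rightComb_mem_diffOpOrder fun k hk =>
      le_sup (f := fun k : Fin s → ℕ => ∑ ν, k ν) hk⟩
  · rintro u ⟨l, hu⟩
    obtain ⟨a, -, hau⟩ := hy.exists_rightComb_eq (N := l + 1) hu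
    exact ⟨a, Set.mem_univ _, hau⟩

end IsPBasis

end

end DiffOps

namespace DiffOps

open Finset

noncomputable section

/-! ### Derivations, simplicity and generators, given a p-basis -/

section General

variable {K B : Type*} [CommRing K] [CommRing B] [Algebra K B]

namespace HigherDerivation

/-- The higher derivation `(b ^ k δₖ)ₖ`. -/
def scale (δ : HigherDerivation K B) (b : B) : HigherDerivation K B where
  comp k := Algebra.lmul K B (b ^ k) * δ.comp k
  comp_zero := by rw [pow_zero, map_one, one_mul, δ.comp_zero]
  leibniz k x z := by
    simp only [Module.End.mul_apply, lmul_apply', δ.leibniz, mul_sum]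
    refine sum_congr rfl fun q hq => ?_
    rw [← mem_antidiagonal.1 hq]
    ring

/-- The first component of a higher derivation is a derivation. -/
def toDerivation (δ : HigherDerivation K B) : Derivation K B B :=
  Derivation.mk' (δ.comp 1) fun a b => by
    rw [δ.leibniz, Nat.antidiagonal_succ]
    simp [δ.comp_zero, mul_comm]

/-- In δₖb = ∑ δₛ(b)δₜ the term t = 0 is δₖ(b) itself, and by induction the other terms lie in I. -/
theorem lmul_comp_mem (δ : HigherDerivation K B) (I : TwoSidedIdeal (diffOp K B))
    {b : B} (hb : ∀ h : Algebra.lmul K B b ∈ diffOp K B, (⟨_, h⟩ : diffOp K B) ∈ I) (k : ℕ)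
    (h : Algebra.lmul K B (δ.comp k b) ∈ diffOp K B) : (⟨_, h⟩ : diffOp K B) ∈ I := by
  have hlm : ∀ a : B, Algebra.lmul K B a ∈ diffOp K B :=
    fun a => ⟨0, lmul_mem_diffOpOrder_zero a⟩
  have hco : ∀ k, δ.comp k ∈ diffOp K B := fun k => ⟨k, δ.comp_mem_diffOpOrder k⟩
  induction k using Nat.strong_induction_on with
  | _ k ih =>
    have h1 : (⟨_, hco k⟩ * ⟨_, hlm b⟩ : diffOp K B) ∈ I := I.mul_mem_left _ _ (hb _)
    have h2 : (⟨_, hco k⟩ * ⟨_, hlm b⟩ : diffOp K B) =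
        ∑ q ∈ antidiagonal k, (⟨_, hlm (δ.comp q.1 b)⟩ * ⟨_, hco q.2⟩ : diffOp K B) := by
      apply Subtype.ext
      rw [AddSubmonoidClass.coe_finsetSum]
      exact δ.comp_mul_lmul k b
    rw [h2, ← add_sum_erase _ _ (show (k, 0) ∈ antidiagonal k by simp)] at h1
    have h3 : (⟨_, hlm (δ.comp k b)⟩ * ⟨_, hco 0⟩ : diffOp K B) = ⟨_, h⟩ := by
      apply Subtype.ext
      change Algebra.lmul K B (δ.comp k b) * δ.comp 0 = _
      rw [δ.comp_zero, mul_one]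
    rw [h3] at h1
    have h4 : ∑ q ∈ (antidiagonal k).erase (k, 0),
        (⟨_, hlm (δ.comp q.1 b)⟩ * ⟨_, hco q.2⟩ : diffOp K B) ∈ I := by
      refine sum_mem fun q hq => I.mul_mem_right _ _ (ih q.1 ?_ _)
      have h5 := mem_antidiagonal.1 (mem_of_mem_erase hq)
      have h6 := ne_of_mem_erase hq
      by_contra hlt
      refine h6 (Prod.ext ?_ ?_)
      · change q.1 = k
        omega
      · change q.2 = 0
        omega
    have h5 := I.sub_mem h1 h4
    exact (add_sub_cancel_right (G := diffOp K B) _ _ : _ = (⟨_, h⟩ : diffOp K B)) ▸ h5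

end HigherDerivation

end General

namespace IsPBasis

variable {B : Type*} [CommRing B] {s p : ℕ} {y : Fin s → B} [CharP B p]

/-- A derivation is linear over p-th powers, so height 1 suffices. -/
theorem derivation_ext (hy : IsPBasis p y) {K : Type*} [CommRing K] [Algebra K B]
    {D D' : Derivation K B B} (h : ∀ ν, D (y ν) = D' (y ν)) : D = D' := by
  have hfrob : ∀ D : Derivation K B B, FrobLinear p 1 (D : B →ₗ[K] B) := by
    intro D c b
    simp [Derivation.leibniz_pow]
  have h1 := hy.ext (hfrob D) (hfrob D') fun α => by
    have hmon : mon y α ∈ Algebra.adjoin K (Set.range y) :=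
      Subalgebra.prod_mem _ fun ν _ => Subalgebra.pow_mem _
        (Algebra.subset_adjoin (Set.mem_range_self ν)) _
    exact Derivation.eqOn_adjoin (by rintro _ ⟨ν, rfl⟩; exact h ν) hmon
  exact Derivation.ext fun b => LinearMap.congr_fun h1 b

theorem sum_smul_derivation_apply {K B ι : Type*} [CommRing K] [CommRing B] [Algebra K B]
    (t : Finset ι) (g : ι → B) (d : ι → Derivation K B B) (b : B) :
    (∑ i ∈ t, g i • d i) b = ∑ i ∈ t, g i * d i b := by
  have h := congrFun (map_sum Derivation.coeFnAddMonoidHom (fun i => g i • d i) t) b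
  rw [Finset.sum_apply] at h
  exact h

theorem linearIndependent_derivations {K B : Type*} [CommRing K] [CommRing B] [Algebra K B]
    {s : ℕ} {y : Fin s → B} {Δ : B}
    (hΔ : IsUnit Δ) {d : Fin s → Derivation K B B}
    (hd : ∀ ν μ, d ν (y μ) = if μ = ν then Δ else 0) : LinearIndependent B d := by
  rw [Fintype.linearIndependent_iff]
  intro g hg ν
  have h := congrArg (fun D : Derivation K B B => D (y ν)) hg
  simp only [sum_smul_derivation_apply, hd,
    mul_ite, mul_zero, sum_ite_eq, mem_univ, if_true, Derivation.zero_apply] at h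
  exact (hΔ.mul_left_eq_zero).1 h

theorem span_derivations (hy : IsPBasis p y) {K : Type*} [CommRing K] [Algebra K B] {Δ : B}
    (hΔ : IsUnit Δ) {d : Fin s → Derivation K B B}
    (hd : ∀ ν μ, d ν (y μ) = if μ = ν then Δ else 0) : Submodule.span B (Set.range d) = ⊤ := by
  obtain ⟨c, hc⟩ := hΔ.exists_left_inv
  rw [eq_top_iff]
  rintro D -
  have : D = ∑ ν, (c * D (y ν)) • d ν := hy.derivation_ext fun μ => by
    simp only [sum_smul_derivation_apply, hd,
      mul_ite, mul_zero, sum_ite_eq, mem_univ, if_true]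
    rw [mul_right_comm, hc, one_mul]
  rw [this]
  exact Submodule.sum_mem _ fun ν _ => Submodule.smul_mem _ _
    (Submodule.subset_span (Set.mem_range_self ν))

variable [Fact p.Prime] (hy : IsPBasis p y) {K : Type*} [Field K] [CharP K p] [PerfectRing K p] [Algebra K B]

theorem higherDerivation_comp_apply_self (ν μ : Fin s) :
    (hy.higherDerivation K ν).comp 1 (y μ) = if μ = ν then 1 else 0 := by
  have h := hy.dividedPower_single_mon (K := K) ν 1 (Pi.single μ 1)
  rw [mon_single, pow_one] at h
  rw [higherDerivation_comp, h]
  split_ifs with hμ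
  · subst hμ
    simp [mon_zero]
  · simp [Ne.symm hμ]

theorem higherDerivation_comp_one {ν : Fin s} {D : Derivation K B B}
    (hD : ∀ μ, D (y μ) = if μ = ν then 1 else 0) :
    (hy.higherDerivation K ν).comp 1 = (D : B →ₗ[K] B) := by
  have h : (hy.higherDerivation K ν).toDerivation = D :=
    hy.derivation_ext fun μ => by
      rw [hD]
      exact hy.higherDerivation_comp_apply_self ν μ
  rw [← h]
  rfl

/-- The k-th component has order at most k < p^k, so its values on monomials determine it. -/
theorem eq_higherDerivation {ν : Fin s} {ε : HigherDerivation K B}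
    (hε : ε.ExtendsDividedPowers y ν) : ε = hy.higherDerivation K ν := by
  apply HigherDerivation.ext
  funext k
  have hk : k < p ^ k := Nat.lt_pow_self (Fact.out : p.Prime).one_lt
  refine hy.ext (e := k) (frobLinear_of_mem_diffOpOrder hk (ε.comp_mem_diffOpOrder k))
    (frobLinear_of_mem_diffOpOrder hk (HigherDerivation.comp_mem_diffOpOrder _ k)) fun α => ?_
  exact (hε k α).trans (hy.higherDerivation_extendsDividedPowers ν k α).symm

/-- Descending induction on |α|: after subtracting the terms of larger degree, already in J, the
operator δ^[α] extracts exactly the coefficient of y^α. -/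
theorem coeffs_pow_mem {J : Ideal B} (hJ : ∀ k, ∀ b ∈ J, hy.dividedPower K k b ∈ J) {b : B}
    (hb : b ∈ J) (e : ℕ) (α : Fin s → Fin (p ^ e)) : hy.coeffs e b α ^ p ^ e ∈ J := by
  classical
  have hbound : ∀ α : Fin s → Fin (p ^ e), ∑ ν, (α ν : ℕ) ≤ s * p ^ e := fun α => by
    simpa using sum_le_card_nsmul univ (fun ν => (α ν : ℕ)) (p ^ e) fun ν _ => (α ν).2.le
  suffices key : ∀ N : ℕ, ∀ α : Fin s → Fin (p ^ e), s * p ^ e < ∑ ν, (α ν : ℕ) + N →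
      hy.coeffs e b α ^ p ^ e ∈ J from key (s * p ^ e + 1) α (by omega)
  intro N
  induction N with
  | zero =>
    intro α hα
    have := hbound α
    omega
  | succ N ih =>
    intro α hα
    set t : Finset (Fin s → Fin (p ^ e)) :=
      univ.filter fun β => ∑ ν, (β ν : ℕ) ≤ ∑ ν, (α ν : ℕ) with ht
    set b' := ∑ β ∈ t, hy.coeffs e b β ^ p ^ e * mon y (fun ν => (β ν : ℕ)) with hb'
    have h1 : b' ∈ J := by
      have hsum := sum_filter_add_sum_filter_not univ
        (fun β : Fin s → Fin (p ^ e) => ∑ ν, (β ν : ℕ) ≤ ∑ ν, (α ν : ℕ))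
        (fun β => hy.coeffs e b β ^ p ^ e * mon y (fun ν => (β ν : ℕ)))
      rw [hy.sum_coeffs] at hsum
      rw [hb', ht, eq_sub_of_add_eq hsum]
      refine J.sub_mem hb (J.sum_mem fun β hβ => J.mul_mem_right _ (ih β ?_))
      have := (mem_filter.1 hβ).2
      omega
    have h2 := hJ (fun ν => (α ν : ℕ)) b' h1
    have hlin := hy.dividedPower_frobLinear_of_lt (K := K) (fun ν => (α ν : ℕ)) (e := e)
      fun ν => (α ν).2
    rw [hb', map_sum, sum_eq_single α, hlin, hy.dividedPower_mon_of_sum_le le_rfl, if_pos rfl,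
      mul_one] at h2
    · exact h2
    · intro β hβ hne
      rw [hlin, hy.dividedPower_mon_of_sum_le (mem_filter.1 hβ).2, if_neg, mul_zero]
      intro h
      exact hne (funext fun ν => Fin.ext (congrFun h ν).symm)
    · intro hα
      exact absurd (by simp [ht]) hα

/-- If J lies in a maximal ideal m, then so do the p^N-th powers of the coefficients of its
elements, hence the coefficients themselves. So J lies in every m^N, and the intersection of these
is zero by Krull. -/
theorem ideal_eq_bot_or_top [IsDomain B] [IsNoetherianRing B] {J : Ideal B}
    (hJ : ∀ k, ∀ b ∈ J, hy.dividedPower K k b ∈ J) : J = ⊥ ∨ J = ⊤ := by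
  by_contra! h
  obtain ⟨m, hm, hJm⟩ := Ideal.exists_le_maximal J h.2
  refine h.1 (eq_bot_iff.2 ?_)
  rw [← Ideal.iInf_pow_eq_bot_of_isDomain m hm.ne_top]
  refine le_iInf fun N => fun b hb => ?_
  rw [← hy.sum_coeffs N b]
  refine Ideal.sum_mem _ fun α _ => Ideal.mul_mem_right _ _ ?_
  have h1 : hy.coeffs N b α ∈ m :=
    hm.isPrime.mem_of_pow_mem _ (hJm (hy.coeffs_pow_mem hJ hb N α))
  exact Ideal.pow_le_pow_right (Nat.lt_pow_self (Fact.out : p.Prime).one_lt).le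
    (Ideal.pow_mem_pow h1 _)

/-- Nonzero commutators with B stay in I and have lower order; an operator commuting with all of B
is a multiplication. -/
theorem exists_lmul_mem {K B : Type*} [CommRing K] [CommRing B] [Algebra K B]
    (I : TwoSidedIdeal (diffOp K B)) {u : diffOp K B} (hu : u ∈ I) (h0 : u ≠ 0) :
    ∃ b : B, b ≠ 0 ∧ ∀ h : Algebra.lmul K B b ∈ diffOp K B, (⟨_, h⟩ : diffOp K B) ∈ I := by
  obtain ⟨u, l, hl⟩ := u
  induction l generalizing u with
  | zero =>
    obtain ⟨b, rfl⟩ := hl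
    refine ⟨b, ?_, fun _ => hu⟩
    rintro rfl
    exact h0 (Subtype.ext (map_zero (Algebra.lmul K B)))
  | succ l ih =>
    by_cases hc : ∃ b : B, Algebra.lmul K B b * u - u * Algebra.lmul K B b ≠ 0
    · obtain ⟨b, hb⟩ := hc
      have hlm : Algebra.lmul K B b ∈ diffOp K B := ⟨0, lmul_mem_diffOpOrder_zero b⟩
      refine ih _ (hl b) ?_ fun h => hb (congrArg Subtype.val h)
      exact I.sub_mem (I.mul_mem_left ⟨_, hlm⟩ _ hu) (I.mul_mem_right _ ⟨_, hlm⟩ hu)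
    · push Not at hc
      have h1 : u = Algebra.lmul K B (u 1) := by
        ext b
        have h2 := LinearMap.congr_fun (hc b) 1
        simp only [LinearMap.sub_apply, Module.End.mul_apply, lmul_apply', LinearMap.zero_apply,
          mul_one] at h2
        rw [lmul_apply', mul_comm, sub_eq_zero.1 h2]
      refine ⟨u 1, fun h => h0 (Subtype.ext ?_), fun h => ?_⟩
      · change u = 0
        rw [h1, h, map_zero]
      · have h3 : (⟨_, h⟩ : diffOp K B) = ⟨u, l + 1, hl⟩ := Subtype.ext h1.symm
        rw [h3]
        exact hu

include hy in
theorem isSimpleRing_diffOp [IsDomain B] [IsNoetherianRing B] : IsSimpleRing (diffOp K B) := by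
  have hlm : ∀ a : B, Algebra.lmul K B a ∈ diffOp K B :=
    fun a => ⟨0, lmul_mem_diffOpOrder_zero a⟩
  have hone : (⟨_, hlm 1⟩ : diffOp K B) = 1 := Subtype.ext (map_one (Algebra.lmul K B))
  have : Nontrivial (diffOp K B) := by
    refine ⟨0, 1, fun h => ?_⟩
    have h1 : (0 : Module.End K B) = 1 := congrArg Subtype.val h
    exact zero_ne_one (LinearMap.congr_fun h1 (1 : B))
  refine ⟨⟨fun I => ?_⟩⟩
  by_contra! hI
  obtain ⟨u, hu, hu0⟩ : ∃ u ∈ I, u ≠ 0 := by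
    by_contra! h
    refine hI.1 (le_antisymm (fun u hu => ?_) bot_le)
    rw [h u hu]
    exact zero_mem _
  obtain ⟨b, hb0, hb⟩ := exists_lmul_mem I hu hu0
  let J : Ideal B :=
    { carrier := {b | (⟨_, hlm b⟩ : diffOp K B) ∈ I}
      add_mem' := fun {a c} ha hc => by
        have h : (⟨_, hlm (a + c)⟩ : diffOp K B) = ⟨_, hlm a⟩ + ⟨_, hlm c⟩ :=
          Subtype.ext (map_add (Algebra.lmul K B) a c)
        change (⟨_, hlm (a + c)⟩ : diffOp K B) ∈ I
        rw [h]
        exact I.add_mem ha hc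
      zero_mem' := by
        have h : (⟨_, hlm 0⟩ : diffOp K B) = 0 := Subtype.ext (map_zero (Algebra.lmul K B))
        change (⟨_, hlm 0⟩ : diffOp K B) ∈ I
        rw [h]
        exact I.zero_mem
      smul_mem' := fun a c hc => by
        have h : (⟨_, hlm (a * c)⟩ : diffOp K B) = ⟨_, hlm a⟩ * ⟨_, hlm c⟩ :=
          Subtype.ext (map_mul (Algebra.lmul K B) a c)
        change (⟨_, hlm (a * c)⟩ : diffOp K B) ∈ I
        rw [h]
        exact I.mul_mem_left _ _ hc }
  have hJ : ∀ k, ∀ b ∈ J, hy.dividedPower K k b ∈ J := by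
    intro k
    rw [← monomialOp_higherDerivation]
    refine monomialOp_induction (fun u => ∀ b ∈ J, u b ∈ J) (fun b hb => hb)
      (fun u v hu hv b hb => hu _ (hv b hb)) fun ν b hb => ?_
    exact HigherDerivation.lmul_comp_mem _ I (fun _ => hb) _ _
  rcases hy.ideal_eq_bot_or_top hJ with h | h
  · exact hb0 ((Submodule.mem_bot B).1 (h ▸ (show b ∈ J from hb _)))
  · refine hI.2 ((TwoSidedIdeal.one_mem_iff I).1 ?_)
    rw [← hone]
    exact (h ▸ Submodule.mem_top : (1 : B) ∈ J)

include hy in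
-- Only multiplications by the coordinates are assumed in T. Any other b is the commutator of bδ^[1]
-- with y_ν, where bδ^[1] is itself a component of a rescaled higher derivation.
theorem adjoin_eq_diffOp (hs : 0 < s) {T : Set (Module.End K B)} (hT : T ⊆ diffOp K B)
    (hTy : ∀ ν, Algebra.lmul K B (y ν) ∈ T)
    (hTc : ∀ (ε : HigherDerivation K B) (k : ℕ), ε.comp k ∈ T) :
    Algebra.adjoin K T = diffOp K B := by
  refine le_antisymm (Algebra.adjoin_le hT) ?_
  rintro u ⟨l, hu⟩
  have hc : ∀ (ε : HigherDerivation K B) (k : ℕ), ε.comp k ∈ Algebra.adjoin K T :=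
    fun ε k => Algebra.subset_adjoin (hTc ε k)
  have hl : ∀ b : B, Algebra.lmul K B b ∈ Algebra.adjoin K T := by
    intro b
    let ν : Fin s := ⟨0, hs⟩
    have h1 := Algebra.subset_adjoin (R := K) (hTy ν)
    have h2 := hc ((hy.higherDerivation K ν).scale b) 1
    have h3 : ((hy.higherDerivation K ν).scale b).comp 1 * Algebra.lmul K B (y ν) -
        Algebra.lmul K B (y ν) * ((hy.higherDerivation K ν).scale b).comp 1 =
        Algebra.lmul K B b := by
      ext x
      have hD := (hy.higherDerivation K ν).toDerivation.leibniz (y ν) x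
      have hD' : (hy.higherDerivation K ν).comp 1 (y ν * x) =
          y ν * (hy.higherDerivation K ν).comp 1 x + x * (hy.higherDerivation K ν).comp 1 (y ν) :=
        hD
      rw [higherDerivation_comp_apply_self, if_pos rfl] at hD'
      simp only [HigherDerivation.scale, LinearMap.sub_apply, Module.End.mul_apply, lmul_apply',
        hD', pow_one]
      ring
    rw [← h3]
    exact sub_mem (mul_mem h2 h1) (mul_mem h1 h2)
  obtain ⟨a, -, rfl⟩ := hy.exists_leftComb_eq (N := l + 1) hu
  rw [leftComb_apply]
  refine sum_mem fun k _ => mul_mem (hl _) ?_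
  rw [← monomialOp_higherDerivation]
  exact monomialOp_induction (· ∈ Algebra.adjoin K T) (one_mem _) (fun u v => mul_mem)
    fun ν => hc _ _

end IsPBasis

end

end DiffOps

namespace DiffOps

open Finset

noncomputable section

/-! ### Generation of B over its p^e-th powers -/

section Unramified

open TensorProduct in
/-- A formally unramified, purely inseparable algebra of finite type and bounded height is a
quotient of the base ring. -/
theorem surjective_algebraMap_of_formallyUnramified {E B : Type*} [CommRing E] [CommRing B]
    [Algebra E B] [Algebra.FormallyUnramified E B] [Algebra.FiniteType E B] (p e : ℕ)
    [Fact p.Prime] [CharP B p] (h : ∀ b : B, b ^ p ^ e ∈ (algebraMap E B).range) :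
    Function.Surjective (algebraMap E B) := by
  have hpos : 0 < p ^ e := pow_pos (Fact.out : p.Prime).pos e
  have hint : Algebra.IsIntegral E B := ⟨fun b => by
    obtain ⟨a, ha⟩ := h b
    refine IsIntegral.of_pow hpos ?_
    rw [← ha]
    exact isIntegral_algebraMap⟩
  have hfin : Module.Finite E B := Algebra.IsIntegral.finite
  -- A finite epimorphism is surjective, so the diagonal ideal has to vanish. It is nil by pure
  -- inseparability, and idempotent by unramifiedness; being finitely generated, it is generated by
  -- an idempotent, which is nilpotent and hence zero.
  rw [← Algebra.isEpi_iff_surjective_algebraMap_of_finite, Algebra.isEpi_iff_forall_one_tmul_eq]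
  have hnil : ∀ b : B, IsNilpotent ((1 : B) ⊗ₜ[E] b - b ⊗ₜ[E] (1 : B)) := by
    intro b
    refine ⟨p ^ e, ?_⟩
    rcases subsingleton_or_nontrivial (B ⊗[E] B) with hs | hn
    · exact Subsingleton.elim _ _
    have hp : ((p : ℕ) : B ⊗[E] B) = 0 := by
      rw [← map_natCast (Algebra.TensorProduct.includeLeft : B →ₐ[E] B ⊗[E] B), CharP.cast_eq_zero,
        map_zero]
    have : CharP (B ⊗[E] B) p := (CharP.charP_iff_prime_eq_zero Fact.out).2 hp
    obtain ⟨a, ha⟩ := h b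
    rw [sub_pow_char_pow, Algebra.TensorProduct.tmul_pow, Algebra.TensorProduct.tmul_pow, one_pow,
      ← ha, Algebra.algebraMap_eq_smul_one, TensorProduct.smul_tmul, sub_self]
  have hle : KaehlerDifferential.ideal E B ≤ nilradical (B ⊗[E] B) := by
    rw [← KaehlerDifferential.span_range_eq_ideal, Ideal.span_le]
    rintro _ ⟨b, rfl⟩
    exact hnil b
  have hidem : IsIdempotentElem (KaehlerDifferential.ideal E B) := by
    rw [← Ideal.cotangent_subsingleton_iff]
    exact Algebra.FormallyUnramified.subsingleton_kaehlerDifferential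
  obtain ⟨ε, hε, hspan⟩ :=
    (Ideal.isIdempotentElem_iff_of_fg _ (KaehlerDifferential.ideal_fg E B)).1 hidem
  have hε0 : ε = 0 := by
    obtain ⟨k, hk⟩ : IsNilpotent ε := hle (hspan ▸ Submodule.mem_span_singleton_self ε)
    rcases Nat.eq_zero_or_pos k with rfl | hk0
    · rw [pow_zero] at hk
      rw [← mul_one ε, hk, mul_zero]
    · rwa [hε.pow_eq (by omega)] at hk
  have hbot : KaehlerDifferential.ideal E B = ⊥ := by
    rw [hspan, hε0]
    exact Submodule.span_zero_singleton _
  intro b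
  have hb := KaehlerDifferential.one_smul_sub_smul_one_mem_ideal E b
  rw [hbot] at hb
  exact sub_eq_zero.1 ((Submodule.mem_bot _).1 hb)

end Unramified

section ChainRule

variable {K B M R : Type*} [CommRing K] [CommRing B] [Algebra K B] [AddCommGroup M] [Module B M]
  [CommRing R] [Algebra R B] [Module R M] {n : ℕ} (x : Fin n → B)

/-- The chain rule. The base R is kept apart from K so that it can be the subring generated by
p^e-th powers and coordinates. -/
theorem derivation_aeval (D : Derivation R B M) (hD : ∀ c : K, D (algebraMap K B c) = 0)
    (g : MvPolynomial (Fin n) K) :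
    D (MvPolynomial.aeval x g) =
      ∑ l, MvPolynomial.aeval x (MvPolynomial.pderiv l g) • D (x l) := by
  induction g using MvPolynomial.induction_on with
  | C a => simp [hD]
  | add P Q hP hQ => simp only [map_add, hP, hQ, add_smul, sum_add_distrib]
  | mul_X P k hP =>
    rw [map_mul, MvPolynomial.aeval_X, Derivation.leibniz, hP, smul_sum]
    simp only [Derivation.leibniz, smul_eq_mul, map_add, map_mul, MvPolynomial.aeval_X, add_smul,
      sum_add_distrib, MvPolynomial.pderiv_X]
    congr 1
    · rw [sum_eq_single k]
      · simp
      · intro l _ hl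
        simp [hl.symm]
      · simp
    · exact sum_congr rfl fun l _ => (mul_smul _ _ _).symm

variable {m r s : ℕ} {f : Fin m → MvPolynomial (Fin n) K} {x} {i : Fin r → Fin m}
  {j : Fin r → Fin n} {c : Fin s → Fin n}

/-- Applying D to the relations f = 0 gives a square linear system for the D(x_j) with invertible
determinant. So D kills all coordinates, hence all polynomials in them, hence their fractions. -/
theorem derivation_eq_zero_of_minor (hf : ∀ k, MvPolynomial.aeval x (f k) = 0)
    (hj : Function.Injective j) (hc : ∀ l, l ∈ Set.range j ∨ l ∈ Set.range c)
    (hdet : IsUnit (Matrix.of fun a b : Fin r =>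
      MvPolynomial.aeval x (MvPolynomial.pderiv (j b) (f (i a)))).det)
    (hgen : ∀ b : B, ∃ g h : MvPolynomial (Fin n) K, IsUnit (MvPolynomial.aeval x h) ∧
      b * MvPolynomial.aeval x h = MvPolynomial.aeval x g)
    (D : Derivation R B M) (hD : ∀ c : K, D (algebraMap K B c) = 0)
    (hDc : ∀ ν, D (x (c ν)) = 0) : D = 0 := by
  set J := Matrix.of fun a b : Fin r =>
      MvPolynomial.aeval x (MvPolynomial.pderiv (j b) (f (i a))) with hJ
  have h1 : ∀ a : Fin r, ∑ b, J a b • D (x (j b)) = 0 := by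
    intro a
    have h2 := derivation_aeval x D hD (f (i a))
    rw [hf, map_zero] at h2
    rw [h2]
    refine Finset.sum_of_injOn j hj.injOn (by simp) ?_ (by simp [hJ])
    intro l _ hl
    rcases hc l with h | ⟨ν, rfl⟩
    · exact absurd (by simpa using h) hl
    · rw [hDc, smul_zero]
  have h3 : ∀ b : Fin r, D (x (j b)) = 0 := by
    intro b
    have h4 : ∑ a, J.adjugate b a • ∑ b', J a b' • D (x (j b')) = 0 := by
      simp only [h1, smul_zero, sum_const_zero]
    simp only [smul_sum, smul_smul] at h4
    rw [sum_comm] at h4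
    simp only [← sum_smul] at h4
    have h5 : ∀ b', ∑ a, J.adjugate b a * J a b' = if b = b' then J.det else 0 := by
      intro b'
      rw [← Matrix.mul_apply, Matrix.adjugate_mul, Matrix.smul_apply, Matrix.one_apply]
      simp
    simp only [h5, ite_smul, zero_smul, sum_ite_eq, mem_univ, if_true] at h4
    exact (hdet.smul_eq_zero).1 h4
  have h6 : ∀ l, D (x l) = 0 := by
    intro l
    rcases hc l with ⟨b, rfl⟩ | ⟨ν, rfl⟩
    · exact h3 b
    · exact hDc ν
  have h7 : ∀ g : MvPolynomial (Fin n) K, D (MvPolynomial.aeval x g) = 0 := by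
    intro g
    rw [derivation_aeval x D hD]
    simp [h6]
  ext b
  obtain ⟨g, h, hu, hb⟩ := hgen b
  have h8 := h7 g
  rw [← hb, Derivation.leibniz, h7, smul_zero, zero_add] at h8
  exact (hu.smul_eq_zero).1 h8

theorem formallyUnramified_of_minor (hf : ∀ k, MvPolynomial.aeval x (f k) = 0)
    (hj : Function.Injective j) (hc : ∀ l, l ∈ Set.range j ∨ l ∈ Set.range c)
    (hdet : IsUnit (Matrix.of fun a b : Fin r =>
      MvPolynomial.aeval x (MvPolynomial.pderiv (j b) (f (i a)))).det)
    (hgen : ∀ b : B, ∃ g h : MvPolynomial (Fin n) K, IsUnit (MvPolynomial.aeval x h) ∧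
      b * MvPolynomial.aeval x h = MvPolynomial.aeval x g)
    (hK : ∀ c : K, algebraMap K B c ∈ (algebraMap R B).range)
    (hRc : ∀ ν, x (c ν) ∈ (algebraMap R B).range) : Algebra.FormallyUnramified R B := by
  refine ⟨?_⟩
  have hzero : ∀ b ∈ (algebraMap R B).range, KaehlerDifferential.D R B b = 0 := by
    rintro _ ⟨a, rfl⟩
    exact Derivation.map_algebraMap _ a
  have h0 := derivation_eq_zero_of_minor (M := Ω[B⁄R]) hf hj hc hdet hgen
    (KaehlerDifferential.D R B) (fun c => hzero _ (hK c)) fun ν => hzero _ (hRc ν)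
  rw [← Submodule.subsingleton_iff (R := B), ← subsingleton_iff_bot_eq_top,
    ← KaehlerDifferential.span_range_derivation, h0]
  symm
  rw [Submodule.span_eq_bot]
  rintro _ ⟨b, rfl⟩
  rfl

end ChainRule

theorem adjoin_frobenius_range_eq_top {K B : Type*} [Field K] {p : ℕ} [Fact p.Prime] [CharP K p]
    [PerfectRing K p] [CommRing B] [Algebra K B] [CharP B p] {n m r s : ℕ} {x : Fin n → B}
    {f : Fin m → MvPolynomial (Fin n) K} {i : Fin r → Fin m} {j : Fin r → Fin n}
    {c : Fin s → Fin n} (hf : ∀ k, MvPolynomial.aeval x (f k) = 0)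
    (hj : Function.Injective j) (hc : ∀ l, l ∈ Set.range j ∨ l ∈ Set.range c)
    (hdet : IsUnit (Matrix.of fun a b : Fin r =>
      MvPolynomial.aeval x (MvPolynomial.pderiv (j b) (f (i a)))).det)
    (hgen : ∀ b : B, ∃ g h : MvPolynomial (Fin n) K, IsUnit (MvPolynomial.aeval x h) ∧
      b * MvPolynomial.aeval x h = MvPolynomial.aeval x g) (e : ℕ) :
    Algebra.adjoin (iterateFrobenius B p e).range (Set.range fun ν => x (c ν)) = ⊤ := by
  set E := Algebra.adjoin (iterateFrobenius B p e).range (Set.range fun ν => x (c ν)) with hE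
  have hpos : 0 < p ^ e := pow_pos (Fact.out : p.Prime).pos e
  have hpow : ∀ b : B, b ^ p ^ e ∈ E := fun b =>
    E.algebraMap_mem ⟨b ^ p ^ e, b, rfl⟩
  have hmem : ∀ b ∈ E, b ∈ (algebraMap E B).range := fun b hb => ⟨⟨b, hb⟩, rfl⟩
  have hK : ∀ a : K, algebraMap K B a ∈ E := by
    intro a
    have ha : algebraMap K B a = algebraMap K B ((iterateFrobeniusEquiv K p e).symm a) ^ p ^ e := by
      rw [← map_pow, ← iterateFrobeniusEquiv_def, RingEquiv.apply_symm_apply]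
    rw [ha]
    exact hpow _
  have hunr : Algebra.FormallyUnramified E B :=
    formallyUnramified_of_minor hf hj hc hdet hgen (fun a => hmem _ (hK a))
      fun ν => hmem _ (Algebra.subset_adjoin ⟨ν, rfl⟩)
  have haeval : ∀ g : MvPolynomial (Fin n) K,
      MvPolynomial.aeval x g ∈ Algebra.adjoin E (Set.range x) := by
    intro g
    induction g using MvPolynomial.induction_on with
    | C a =>
      rw [MvPolynomial.aeval_C]
      exact (Algebra.adjoin E (Set.range x)).algebraMap_mem ⟨_, hK a⟩
    | add P Q hP hQ =>
      rw [map_add]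
      exact add_mem hP hQ
    | mul_X P k hP =>
      rw [map_mul, MvPolynomial.aeval_X]
      exact mul_mem hP (Algebra.subset_adjoin ⟨k, rfl⟩)
  have hft : Algebra.FiniteType E B := by
    refine ⟨⟨(Set.finite_range x).toFinset, ?_⟩⟩
    rw [Set.Finite.coe_toFinset, eq_top_iff]
    rintro b -
    obtain ⟨g, h, hu, hb⟩ := hgen b
    obtain ⟨t, ht⟩ := hu.exists_right_inv
    -- The inverse t of h equals h^(p^e − 1) t^(p^e), and t^(p^e) lies in E. So the coordinates
    -- generate B over E although B is a localization.
    have hb' : b = MvPolynomial.aeval x g * MvPolynomial.aeval x h ^ (p ^ e - 1) * t ^ p ^ e := by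
      have h1 : MvPolynomial.aeval x h ^ (p ^ e - 1) * t ^ p ^ e = t := by
        conv_lhs => rw [← Nat.sub_add_cancel hpos, pow_succ t, ← mul_assoc, Nat.add_sub_cancel,
          ← mul_pow, ht, one_pow, one_mul]
      rw [mul_assoc, h1, ← hb, mul_assoc, ht, mul_one]
    rw [hb']
    exact mul_mem (mul_mem (haeval g) (pow_mem (haeval h) _))
      ((Algebra.adjoin E (Set.range x)).algebraMap_mem ⟨_, hpow t⟩)
  rw [eq_top_iff]
  rintro b -
  obtain ⟨a, rfl⟩ := surjective_algebraMap_of_formallyUnramified (E := E) p e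
    (fun b => hmem _ (hpow b)) b
  exact a.2

end

end DiffOps

namespace DiffOps

open Finset

noncomputable section

/-! ### The derivations given by minors -/

section MinorDerivation

variable {K : Type*} [Field K] {m n : ℕ} (f : Fin m → MvPolynomial (Fin n) K)
  (A : Type*) [CommRing A] [Algebra (MvPolynomial (Fin n) K ⧸ Ideal.span (Set.range f)) A]

theorem bar_generator (k : Fin m) : bar f A (f k) = 0 := by
  rw [bar, RingHom.comp_apply, Ideal.Quotient.eq_zero_iff_mem.2
    (Ideal.subset_span (Set.mem_range_self k)), map_zero]

theorem algebraMap_bar_eq_aeval [Algebra K A]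
    [IsScalarTower K (MvPolynomial (Fin n) K ⧸ Ideal.span (Set.range f)) A]
    (B : Type*) [CommRing B] [Algebra K B] [Algebra A B] [IsScalarTower K A B]
    (g : MvPolynomial (Fin n) K) :
    algebraMap A B (bar f A g) =
      MvPolynomial.aeval (fun l => algebraMap A B (bar f A (MvPolynomial.X l))) g := by
  induction g using MvPolynomial.induction_on with
  | C a =>
    rw [MvPolynomial.aeval_C, IsScalarTower.algebraMap_apply K A B,
      IsScalarTower.algebraMap_apply K (MvPolynomial (Fin n) K ⧸ Ideal.span (Set.range f)) A]
    rfl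
  | add P Q hP hQ => simp only [map_add, hP, hQ]
  | mul_X P k hP => simp only [map_mul, hP, MvPolynomial.aeval_X]

variable {r : ℕ} (i : Fin r → Fin m) (j : Fin r → Fin n)

/-- Cofactors of the entries of the last row in the determinant defining `minorDerivValue`. -/
def minorCofactor (j' : Fin n) (b : Fin (r + 1)) : A :=
  (-1) ^ (r + (b : ℕ)) * ((jacobiMatrix f A).submatrix i
    fun b' => (Fin.snoc j j' : Fin (r + 1) → Fin n) (b.succAbove b')).det

theorem minorDerivValue_eq_sum (j' : Fin n) (g : MvPolynomial (Fin n) K) :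
    minorDerivValue f A i j j' g = ∑ b : Fin (r + 1),
      bar f A (MvPolynomial.pderiv ((Fin.snoc j j' : Fin (r + 1) → Fin n) b) g) *
        minorCofactor f A i j j' b := by
  rw [minorDerivValue, Matrix.det_succ_row _ (Fin.last r)]
  refine sum_congr rfl fun b _ => ?_
  rw [minorCofactor, mul_left_comm, ← mul_assoc]
  congr 1
  · simp
  · refine congrArg Matrix.det (Matrix.ext fun a' b' => ?_)
    simp

/-- The determinant is linear in its last row, the gradient of g; so it has the form of a vector
field with prescribed values on the coordinates. -/
theorem minorDerivValue_eq_sum_X (j' : Fin n) (g : MvPolynomial (Fin n) K) :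
    minorDerivValue f A i j j' g = ∑ l,
      bar f A (MvPolynomial.pderiv l g) * minorDerivValue f A i j j' (MvPolynomial.X l) := by
  classical
  simp only [minorDerivValue_eq_sum, mul_sum]
  rw [sum_comm]
  refine sum_congr rfl fun b _ => ?_
  rw [sum_eq_single ((Fin.snoc j j' : Fin (r + 1) → Fin n) b)]
  · simp
  · intro l _ hl
    rw [MvPolynomial.pderiv_X_of_ne hl]
    simp
  · simp

/-- Only the last column can contribute, and its cofactor is Δ. This makes the derivations dual to
the free coordinates, up to Δ. -/
theorem minorDerivValue_X {j' l : Fin n} (hl : l ∉ Set.range j) :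
    minorDerivValue f A i j j' (MvPolynomial.X l) =
      if l = j' then jacobiMinor f A i j else 0 := by
  rw [minorDerivValue_eq_sum, Fin.sum_univ_castSucc, sum_eq_zero, zero_add]
  · rw [Fin.snoc_last]
    split_ifs with h
    · subst h
      rw [MvPolynomial.pderiv_X_self, map_one, one_mul, minorCofactor, Fin.val_last,
        Even.neg_one_pow ⟨r, rfl⟩, one_mul, jacobiMinor]
      congr 2
      funext b'
      simp
    · rw [MvPolynomial.pderiv_X_of_ne h, map_zero, zero_mul]
  · intro b _
    rw [Fin.snoc_castSucc, MvPolynomial.pderiv_X_of_ne, map_zero, zero_mul]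
    rintro rfl
    exact hl ⟨b, rfl⟩

/-- For g = f_k the value is an (r + 1)-minor of a matrix of rank r. -/
theorem minorDerivValue_generator [IsDomain A]
    (hr : ((jacobiMatrix f A).map (algebraMap A (FractionRing A))).rank = r) (j' : Fin n)
    (k : Fin m) : minorDerivValue f A i j j' (f k) = 0 := by
  set J := (jacobiMatrix f A).map (algebraMap A (FractionRing A)) with hJ
  set row : Fin (r + 1) → Fin m := Fin.snoc (α := fun _ => Fin m) i k with hrow
  set col : Fin (r + 1) → Fin n := Fin.snoc (α := fun _ => Fin n) j j' with hcol
  have h1 : minorDerivValue f A i j j' (f k) = ((jacobiMatrix f A).submatrix row col).det := by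
    rw [minorDerivValue]
    congr 1
    ext a b
    refine Fin.lastCases ?_ (fun a' => ?_) a
    · simp [hrow, hcol, jacobiMatrix]
    · simp [hrow, hcol]
  rw [h1]
  apply IsFractionRing.injective A (FractionRing A)
  rw [map_zero, RingHom.map_det]
  by_contra h2
  have h3 : (J.submatrix row col).rank = r + 1 := by
    have := Matrix.rank_of_isUnit (J.submatrix row col)
      ((Matrix.isUnit_iff_isUnit_det _).2 (isUnit_iff_ne_zero.2 h2))
    simpa using this
  have h4 := J.rank_submatrix_le row col
  omega

end MinorDerivation

/-- A derivation of B is a ring map from B to the dual numbers over B lifting the identity. The map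
x ↦ x + εv on polynomials kills I by `hv`, and it passes to both localizations because units of the
dual numbers are detected modulo ε. -/
theorem exists_derivation_apply_eq {K : Type*} [Field K] {m n : ℕ}
    (f : Fin m → MvPolynomial (Fin n) K)
    (S : Submonoid (MvPolynomial (Fin n) K ⧸ Ideal.span (Set.range f)))
    (A : Type*) [CommRing A] [Algebra K A]
    [Algebra (MvPolynomial (Fin n) K ⧸ Ideal.span (Set.range f)) A]
    [IsScalarTower K (MvPolynomial (Fin n) K ⧸ Ideal.span (Set.range f)) A]
    [IsLocalization S A] (Δ : A)
    {B : Type*} [CommRing B] [Algebra K B] [Algebra A B] [IsScalarTower K A B]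
    [IsLocalization.Away Δ B] (x v : Fin n → B)
    (hx : ∀ l, x l = algebraMap A B (bar f A (MvPolynomial.X l)))
    (hgen : ∀ b : B, ∃ g h : MvPolynomial (Fin n) K, IsUnit (MvPolynomial.aeval x h) ∧
      b * MvPolynomial.aeval x h = MvPolynomial.aeval x g)
    (hv : ∀ k, ∑ l, MvPolynomial.aeval x (MvPolynomial.pderiv l (f k)) * v l = 0) :
    ∃ D : Derivation K B B, ∀ l, D (x l) = v l := by
  have hbar : ∀ g, algebraMap A B (bar f A g) = MvPolynomial.aeval x g := fun g => by
    rw [algebraMap_bar_eq_aeval]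
    congr 2
    exact (funext hx).symm
  let φ : MvPolynomial (Fin n) K →ₐ[K] TrivSqZeroExt B B :=
    MvPolynomial.aeval fun l => TrivSqZeroExt.inl (x l) + TrivSqZeroExt.inr (v l)
  have hφ1 : ∀ g, (φ g).fst = MvPolynomial.aeval x g := by
    intro g
    induction g using MvPolynomial.induction_on with
    | C a => simp [φ, TrivSqZeroExt.algebraMap_eq_inl']
    | add P Q hP hQ => simp only [map_add, TrivSqZeroExt.fst_add, hP, hQ]
    | mul_X P k hP => simp [φ] at hP ⊢; rw [hP]
  have hφ2 : ∀ g, (φ g).snd = ∑ l, MvPolynomial.aeval x (MvPolynomial.pderiv l g) * v l := by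
    intro g
    induction g using MvPolynomial.induction_on with
    | C a => simp [φ, TrivSqZeroExt.algebraMap_eq_inl']
    | add P Q hP hQ => simp only [map_add, TrivSqZeroExt.snd_add, hP, hQ, add_mul, sum_add_distrib]
    | mul_X P k hP =>
      have hX : φ (MvPolynomial.X k) = TrivSqZeroExt.inl (x k) + TrivSqZeroExt.inr (v k) :=
        MvPolynomial.aeval_X _ _
      rw [map_mul, TrivSqZeroExt.snd_mul, hφ1, hP, hX]
      simp only [Derivation.leibniz, smul_eq_mul, map_add, map_mul, MvPolynomial.aeval_X, add_mul,
        sum_add_distrib, MvPolynomial.pderiv_X, TrivSqZeroExt.snd_add, TrivSqZeroExt.snd_inl,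
        TrivSqZeroExt.snd_inr, zero_add, TrivSqZeroExt.fst_add, TrivSqZeroExt.fst_inl,
        TrivSqZeroExt.fst_inr, add_zero, MulOpposite.smul_eq_mul_unop, MulOpposite.unop_op]
      congr 1
      · rw [sum_eq_single k]
        · simp
        · intro l _ hl
          simp [hl.symm]
        · simp
      · rw [sum_mul]
        exact sum_congr rfl fun l _ => by ring
  have hφ0 : ∀ g ∈ Ideal.span (Set.range f), φ g = 0 := by
    intro g hg
    have hle : Ideal.span (Set.range f) ≤ RingHom.ker (φ : _ →+* TrivSqZeroExt B B) := by
      rw [Ideal.span_le]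
      rintro _ ⟨k, rfl⟩
      refine TrivSqZeroExt.ext ?_ ?_
      · refine (hφ1 _).trans ?_
        rw [← hbar, bar_generator, map_zero]
        rfl
      · exact (hφ2 _).trans (hv k)
    exact hle hg
  let φ₁ : MvPolynomial (Fin n) K ⧸ Ideal.span (Set.range f) →+* TrivSqZeroExt B B :=
    Ideal.Quotient.lift _ (φ : _ →+* TrivSqZeroExt B B) hφ0
  have hφ₁ : ∀ t : S, IsUnit (φ₁ t) := by
    rintro ⟨t, ht⟩
    obtain ⟨g, rfl⟩ := Ideal.Quotient.mk_surjective t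
    rw [TrivSqZeroExt.isUnit_iff_isUnit_fst]
    change IsUnit (φ g).fst
    rw [hφ1, ← hbar]
    exact (IsLocalization.map_units A (⟨_, ht⟩ : S)).map (algebraMap A B)
  let φ₂ : A →+* TrivSqZeroExt B B := IsLocalization.lift hφ₁
  have hφ₂ : ∀ g, φ₂ (bar f A g) = φ g := fun g => IsLocalization.lift_eq hφ₁ _
  have hφ₂1 : ∀ a, (φ₂ a).fst = algebraMap A B a := by
    intro a
    have h : (TrivSqZeroExt.fstHom B B B : TrivSqZeroExt B B →+* B).comp φ₂ = algebraMap A B := by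
      refine IsLocalization.ringHom_ext S (RingHom.ext fun t => ?_)
      obtain ⟨g, rfl⟩ := Ideal.Quotient.mk_surjective t
      change (φ₂ (bar f A g)).fst = algebraMap A B (bar f A g)
      rw [hφ₂, hφ1, hbar]
    exact RingHom.congr_fun h a
  have hΔ : IsUnit (φ₂ Δ) := by
    rw [TrivSqZeroExt.isUnit_iff_isUnit_fst, hφ₂1]
    exact IsLocalization.Away.algebraMap_isUnit Δ
  let ψ : B →+* TrivSqZeroExt B B := IsLocalization.Away.lift Δ hΔ
  have hψ : ∀ g, ψ (MvPolynomial.aeval x g) = φ g := by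
    intro g
    rw [← hbar, ← hφ₂]
    exact IsLocalization.Away.lift_eq Δ hΔ _
  have hψ1 : ∀ b, (ψ b).fst = b := by
    intro b
    obtain ⟨g, h, hu, hb⟩ := hgen b
    have h1 := congrArg (fun b => (ψ b).fst) hb
    simp only [map_mul, TrivSqZeroExt.fst_mul, hψ, hφ1] at h1
    exact hu.mul_right_cancel (h1.trans hb.symm)
  have hψK : ∀ a : K, ψ (algebraMap K B a) = TrivSqZeroExt.inl (algebraMap K B a) := by
    intro a
    rw [← MvPolynomial.aeval_C x, hψ]
    simp [φ, TrivSqZeroExt.algebraMap_eq_inl']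
  refine ⟨Derivation.mk' { toFun := fun b => (ψ b).snd
                           map_add' := fun a b => by simp
                           map_smul' := fun a b => ?_ } fun a b => ?_, fun l => ?_⟩
  · rw [Algebra.smul_def, map_mul, TrivSqZeroExt.snd_mul, hψK]
    simp [Algebra.smul_def]
  · simp [hψ1, mul_comm]
  · change (ψ (x l)).snd = v l
    rw [← MvPolynomial.aeval_X (R := K) x l, hψ]
    simp [φ]

end

end DiffOps

namespace DiffOps

noncomputable section

/-! ### Fractions of polynomials, and the role of non-maximality -/

section Localization

variable {K : Type*} [Field K] {m n : ℕ} {f : Fin m → MvPolynomial (Fin n) K}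

theorem exists_mul_aeval_eq_aeval
    (S : Submonoid (MvPolynomial (Fin n) K ⧸ Ideal.span (Set.range f)))
    (A : Type*) [CommRing A] [Algebra K A]
    [Algebra (MvPolynomial (Fin n) K ⧸ Ideal.span (Set.range f)) A]
    [IsScalarTower K (MvPolynomial (Fin n) K ⧸ Ideal.span (Set.range f)) A]
    [IsLocalization S A] (Q : MvPolynomial (Fin n) K)
    (B : Type*) [CommRing B] [Algebra K B] [Algebra A B] [IsScalarTower K A B]
    [IsLocalization.Away (bar f A Q) B] (x : Fin n → B)
    (hx : ∀ g, algebraMap A B (bar f A g) = MvPolynomial.aeval x g) (b : B) :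
    ∃ g h : MvPolynomial (Fin n) K, IsUnit (MvPolynomial.aeval x h) ∧
      b * MvPolynomial.aeval x h = MvPolynomial.aeval x g := by
  obtain ⟨⟨a, ⟨_, k, rfl⟩⟩, hb⟩ := IsLocalization.surj (Submonoid.powers (bar f A Q)) b
  obtain ⟨⟨t, u⟩, ha⟩ := IsLocalization.surj S a
  obtain ⟨g, rfl⟩ := Ideal.Quotient.mk_surjective t
  obtain ⟨u, hu⟩ := u
  obtain ⟨h, rfl⟩ := Ideal.Quotient.mk_surjective u
  have ha' : a * bar f A h = bar f A g := ha
  have hb' : b * algebraMap A B (bar f A Q ^ k) = algebraMap A B a := hb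
  have hunit : IsUnit (bar f A h) := IsLocalization.map_units A (⟨_, hu⟩ : S)
  refine ⟨g, Q ^ k * h, ?_, ?_⟩
  · rw [← hx, map_mul, map_pow, map_mul, map_pow]
    exact ((IsLocalization.Away.algebraMap_isUnit (bar f A Q)).pow k).mul
      (hunit.map (algebraMap A B))
  · rw [← hx, ← hx, ← ha', map_mul, map_mul, map_mul, map_pow, ← hb', mul_assoc]

/-- An unramified algebra essentially of finite type over a field is finite over it. The quotient by
I embeds in B, so it is a finite-dimensional domain, hence a field. -/
theorem isMaximal_of_formallyUnramified (hprime : (Ideal.span (Set.range f)).IsPrime)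
    (S : Submonoid (MvPolynomial (Fin n) K ⧸ Ideal.span (Set.range f)))
    (A : Type*) [CommRing A] [IsDomain A] [Algebra K A]
    [Algebra (MvPolynomial (Fin n) K ⧸ Ideal.span (Set.range f)) A]
    [IsScalarTower K (MvPolynomial (Fin n) K ⧸ Ideal.span (Set.range f)) A]
    [IsLocalization S A] {Δ : A} (hΔ : Δ ≠ 0)
    (B : Type*) [CommRing B] [Algebra K B] [Algebra A B] [IsScalarTower K A B]
    [IsLocalization.Away Δ B] [Algebra.FormallyUnramified K B] :
    (Ideal.span (Set.range f)).IsMaximal := by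
  have hdom : IsDomain (MvPolynomial (Fin n) K ⧸ Ideal.span (Set.range f)) :=
    Ideal.Quotient.isDomain _
  have : Algebra.EssFiniteType (MvPolynomial (Fin n) K ⧸ Ideal.span (Set.range f)) A :=
    .of_isLocalization A S
  have : Algebra.EssFiniteType K A :=
    .comp K (MvPolynomial (Fin n) K ⧸ Ideal.span (Set.range f)) A
  have : Algebra.EssFiniteType A B := .of_isLocalization B (Submonoid.powers Δ)
  have : Algebra.EssFiniteType K B := .comp K A B
  have hfin : Module.Finite K B := Algebra.FormallyUnramified.finite_of_free K B
  have hS : S ≤ nonZeroDivisors (MvPolynomial (Fin n) K ⧸ Ideal.span (Set.range f)) := by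
    intro t ht
    rw [mem_nonZeroDivisors_iff_ne_zero]
    rintro rfl
    have := IsLocalization.map_units A (⟨0, ht⟩ : S)
    rw [map_zero] at this
    exact not_isUnit_zero this
  have hinj : Function.Injective ((IsScalarTower.toAlgHom K A B).comp
      (IsScalarTower.toAlgHom K (MvPolynomial (Fin n) K ⧸ Ideal.span (Set.range f)) A)) :=
    (IsLocalization.injective B (powers_le_nonZeroDivisors_of_noZeroDivisors hΔ)).comp
      (IsLocalization.injective A hS)
  have hfin' : Module.Finite K (MvPolynomial (Fin n) K ⧸ Ideal.span (Set.range f)) :=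
    Module.Finite.of_injective ((IsScalarTower.toAlgHom K A B).comp (IsScalarTower.toAlgHom K
      (MvPolynomial (Fin n) K ⧸ Ideal.span (Set.range f)) A)).toLinearMap hinj
  exact Ideal.Quotient.maximal_of_isField _
    (isField_of_isIntegral_of_isField' (Field.toIsField K))

end Localization

end

end DiffOps

/-! ### Assembly of the theorem -/

theorem theorem2p5
    {K : Type*} [Field K] (p : ℕ) [Fact p.Prime] [CharP K p] [PerfectField K]
    {m n : ℕ} (f : Fin m → MvPolynomial (Fin n) K)
    -- `I = (f₁, …, fₘ)` is prime, but not maximal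
    (hprime : (Ideal.span (Set.range f)).IsPrime)
    (hmax : ¬ (Ideal.span (Set.range f)).IsMaximal)
    -- `A = S⁻¹(K[x₁, …, xₙ]/I)`, a domain
    (S : Submonoid (MvPolynomial (Fin n) K ⧸ Ideal.span (Set.range f)))
    (A : Type*) [CommRing A] [IsDomain A] [Algebra K A]
    [Algebra (MvPolynomial (Fin n) K ⧸ Ideal.span (Set.range f)) A]
    [IsScalarTower K (MvPolynomial (Fin n) K ⧸ Ideal.span (Set.range f)) A]
    [IsLocalization S A]
    -- `r` is the rank of the Jacobi matrix over the field of fractions of `A`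
    {r : ℕ} (hr : ((jacobiMatrix f A).map (algebraMap A (FractionRing A))).rank = r)
    -- the nonzero minor `Δ = Δ(i, j)`
    (i : Fin r ↪o Fin m) (j : Fin r ↪o Fin n) (hΔ : jacobiMinor f A i j ≠ 0)
    -- `c` enumerates the complement of `{j₁, …, jᵣ}`
    {s : ℕ} (c : Fin s ↪ Fin n) (hc : Set.range c = (Set.range j)ᶜ)
    -- `B = A_Δ`
    (B : Type*) [CommRing B] [Algebra K B] [Algebra A B] [IsScalarTower K A B]
    [IsLocalization.Away (jacobiMinor f A i j) B] :
    ∃ (d : Fin s → Derivation K B B) (δ : Fin s → HigherDerivation K B),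
      -- `d ν` is the derivation `∂_{i; j, c ν}` of `B`
      (∀ ν, IsMinorDerivation f A i j (c ν) (d ν)) ∧
      -- `δ ν` is the unique iterative higher derivation attached to `Δ⁻¹ ∂_{i; j, c ν}`
      (∀ ν, (δ ν).IsAttachedTo
        (IsLocalization.Away.invSelf (S := B) (jacobiMinor f A i j) • d ν)
        (fun μ => algebraMap A B (bar f A (MvPolynomial.X (c μ)))) ν) ∧
      (∀ ν, ∀ ε : HigherDerivation K B, ε.IsAttachedTo
        (IsLocalization.Away.invSelf (S := B) (jacobiMinor f A i j) • d ν)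
        (fun μ => algebraMap A B (bar f A (MvPolynomial.X (c μ)))) ν → ε = δ ν) ∧
      -- all their components commute
      (∀ ν μ k l, Commute ((δ ν).comp k) ((δ μ).comp l)) ∧
      -- (1) `𝒟(B)` is simple, is the direct sum of the `B δ^[k]` and of the `δ^[k] B`, and is
      -- generated by `A` and the components of the higher derivations of `B`
      IsSimpleRing (diffOp K B) ∧
      IsLeftFreeOn (diffOp K B : Set (Module.End K B)) (monomialOp δ) ∧
      IsRightFreeOn (diffOp K B : Set (Module.End K B)) (monomialOp δ) ∧
      Algebra.adjoin K
        ((Set.range fun a : A => Algebra.lmul K B (algebraMap A B a)) ∪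
          {u | ∃ (ε : HigherDerivation K B) (k : ℕ), u = ε.comp k}) = diffOp K B ∧
      -- (2) `Der_K(B)` is free on the `∂_{i; j, c ν}`
      (LinearIndependent B d ∧ Submodule.span B (Set.range d) = ⊤) ∧
      -- (3) the order filtration is given by the total degree
      (∀ l : ℕ,
        IsLeftFreeOn (diffOpOrder K B l : Set (Module.End K B))
          (fun k : {k : Fin s → ℕ // ∑ ν, k ν ≤ l} => monomialOp δ k) ∧
        IsRightFreeOn (diffOpOrder K B l : Set (Module.End K B))
          (fun k : {k : Fin s → ℕ // ∑ ν, k ν ≤ l} => monomialOp δ k)) := by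
  classical
  have : PerfectRing K p := PerfectField.toPerfectRing p
  set Δ := jacobiMinor f A i j with hΔdef
  have : IsDomain B := IsLocalization.isDomain_of_le_nonZeroDivisors B
    (powers_le_nonZeroDivisors_of_noZeroDivisors hΔ)
  have : CharP B p := charP_of_injective_algebraMap (algebraMap K B).injective p
  have : IsNoetherianRing A := IsLocalization.isNoetherianRing S A inferInstance
  have : IsNoetherianRing B := IsLocalization.isNoetherianRing (Submonoid.powers Δ) B inferInstance
  let x : Fin n → B := fun l => algebraMap A B (bar f A (MvPolynomial.X l))
  let y : Fin s → B := fun ν => x (c ν)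
  have hx : ∀ g, algebraMap A B (bar f A g) = MvPolynomial.aeval x g :=
    algebraMap_bar_eq_aeval f A B
  have hf : ∀ k, MvPolynomial.aeval x (f k) = 0 := fun k => by
    rw [← hx, bar_generator, map_zero]
  have hΔu : IsUnit (algebraMap A B Δ) := IsLocalization.Away.algebraMap_isUnit Δ
  -- Δ is lifted to a polynomial, so that every element of B is a fraction of polynomials in the
  -- coordinates.
  have hQ : bar f A (Matrix.of fun a b : Fin r => MvPolynomial.pderiv (j b) (f (i a))).det = Δ := by
    rw [RingHom.map_det]
    rfl
  have hloc : IsLocalization.Away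
      (bar f A (Matrix.of fun a b : Fin r => MvPolynomial.pderiv (j b) (f (i a))).det) B := by
    rw [hQ]
    infer_instance
  have hgen := exists_mul_aeval_eq_aeval S A
    (Matrix.of fun a b : Fin r => MvPolynomial.pderiv (j b) (f (i a))).det B x hx
  have hdet : IsUnit (Matrix.of fun a b : Fin r =>
      MvPolynomial.aeval x (MvPolynomial.pderiv (j b) (f (i a)))).det := by
    convert hΔu using 1
    rw [hΔdef, jacobiMinor, RingHom.map_det]
    refine congrArg Matrix.det (Matrix.ext fun a b => ?_)
    exact (hx _).symm
  have hcj : ∀ ν, c ν ∉ Set.range j := fun ν => by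
    have : c ν ∈ Set.range c := ⟨ν, rfl⟩
    rwa [hc] at this
  have hcov : ∀ l, l ∈ Set.range j ∨ l ∈ Set.range c := fun l => by
    rw [hc]
    exact em _
  -- With no free coordinates the minor criterion would make B unramified over K itself, and I would
  -- be maximal.
  have hs : 0 < s := by
    by_contra h0
    have hs0 : s = 0 := by omega
    subst hs0
    have : Algebra.FormallyUnramified K B := formallyUnramified_of_minor hf j.injective hcov hdet
      hgen (fun a => ⟨a, rfl⟩) fun ν => ν.elim0
    exact hmax (isMaximal_of_formallyUnramified hprime S A hΔ B)
  have hex : ∀ ν, ∃ D : Derivation K B B, ∀ l,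
      D (x l) = algebraMap A B (minorDerivValue f A i j (c ν) (MvPolynomial.X l)) := fun ν => by
    refine exists_derivation_apply_eq f S A Δ x _ (fun l => rfl) hgen fun k => ?_
    simp only [← hx, ← map_mul, ← map_sum]
    rw [← minorDerivValue_eq_sum_X, minorDerivValue_generator f A i j hr, map_zero]
  choose d hd using hex
  have hminor : ∀ ν, IsMinorDerivation f A i j (c ν) (d ν) := fun ν g => by
    rw [hx, derivation_aeval x (d ν) (fun a => (d ν).map_algebraMap a), minorDerivValue_eq_sum_X,
      map_sum]
    refine Finset.sum_congr rfl fun l _ => ?_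
    rw [hd, ← hx, map_mul, smul_eq_mul]
  have hdy : ∀ ν μ, d ν (y μ) = if μ = ν then algebraMap A B Δ else 0 := fun ν μ => by
    rw [hd, minorDerivValue_X f A i j (hcj μ), apply_ite (algebraMap A B), map_zero]
    simp only [c.injective.eq_iff]
    rfl
  have hdy' : ∀ ν μ, (IsLocalization.Away.invSelf (S := B) Δ • d ν) (y μ) =
      if μ = ν then 1 else 0 := fun ν μ => by
    rw [Derivation.smul_apply, hdy, smul_eq_mul, mul_ite, mul_zero, mul_comm,
      IsLocalization.Away.mul_invSelf]
  have hy : IsPBasis p y := IsPBasis.of_derivations y _ hdy'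
    (adjoin_frobenius_range_eq_top hf j.injective hcov hdet hgen)
  have hmon : monomialOp (hy.higherDerivation K) = hy.dividedPower K :=
    funext hy.monomialOp_higherDerivation
  refine ⟨d, hy.higherDerivation K, hminor, fun ν => ⟨hy.higherDerivation_isIterative ν,
    hy.higherDerivation_comp_one (hdy' ν), hy.higherDerivation_extendsDividedPowers ν⟩,
    fun ν ε hε => hy.eq_higherDerivation hε.extends_dividedPowers,
    fun ν μ k l => hy.dividedPower_commute _ _, hy.isSimpleRing_diffOp, ?_, ?_, ?_,
    ⟨IsPBasis.linearIndependent_derivations hΔu hdy, hy.span_derivations hΔu hdy⟩, fun l => ?_⟩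
  · rw [hmon]
    exact hy.isLeftFreeOn_diffOp
  · rw [hmon]
    exact hy.isRightFreeOn_diffOp
  · refine hy.adjoin_eq_diffOp hs ?_ (fun ν => Or.inl ⟨_, rfl⟩) fun ε k => Or.inr ⟨ε, k, rfl⟩
    rintro _ (⟨a, rfl⟩ | ⟨ε, k, rfl⟩)
    · exact ⟨0, lmul_mem_diffOpOrder_zero _⟩
    · exact ⟨k, ε.comp_mem_diffOpOrder k⟩
  · rw [hmon]
    exact ⟨hy.isLeftFreeOn_diffOpOrder l, hy.isRightFreeOn_diffOpOrder l⟩
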